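/- Let $x_0\sim p_0$ and $x_1\sim p_1$ be random vectors in $\mathbb R^d$ on a common probability space (with any joint law, e.g. independent) such that $\mathbb E\|x_1-x_0\|^2<\infty$. Put $x_t=(1-t)x_0+t x_1$, $v^*=x_1-x_0$, and let $p_t$ be the law of $x_t$. For a measurable field $v=v(x,t,\alpha)\in\mathbb R^d$ and $k\ge 1$ define, with $t\sim\mathcal U(0,1)$ and $\alpha\sim\mathcal U(t,1)$ given $t$, $(t,\alpha)$ independent of $(x_0,x_1)$, $$\mathcal L_{\rm pri}(v)=\mathbb E\|v(x_t,t,1)-v^*\|^2,\qquad \mathcal L^{(k)}_{\rm sec}(v)=\mathbb E\|v(x_t,t/\alpha^k,\alpha^k)-\alpha^k v^*\|^2,$$ $$\mathcal L^{(k)}_{\rm cons}(v)=\mathbb E\|v(x_t,t/\alpha^k,\alpha^k)-\alpha^k v(x_t,t,1)\|^2,$$ and, for a recursion depth $D\ge 2$ and a weight $\lambda\ge 0$, $$\mathcal L_{\rm total}=\mathcal L_{\rm pri}+\sum_{k=1}^{D-1}\mathcal L^{(k)}_{\rm sec}+\lambda\sum_{k=1}^{D-1}\mathcal L^{(k)}_{\rm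 cons}.$$ Let $(v_\theta)_{\theta\in\Theta}$ be a class of measurable fields that is expressive enough, in the sense that the infimum of $\mathcal L_{\rm total}$ over the class is not larger than its infimum over all measurable fields, and let $\theta^*$ be a global minimizer of $\theta\mapsto\mathcal L_{\rm total}(v_\theta)$. Then: 1. A measurable field $w$ minimizes $\mathcal L_{\rm pri}$ among all measurable fields if and only if $w(x,t,1)=\mathbb E[x_1-x_0\mid x_t=x]$ for a.e. $t\in[0,1]$ and $p_t$-a.e. $x$. For $k\ge1$, it minimizes $\mathcal L^{(k)}_{\rm sec}$ if and only if $w(x,t/\alpha^k,\alpha^k)=\alpha^k\,\mathbb E[x_1-x_0\mid x_t=x]$ for a.e. $t\in[0,1]$, a.e. $\alpha\in[t,1]$ and $p_t$-a.e. $x$. The field $v_{\theta^*}$ minimizes $\mathcal L_{\rm pri}$ and $\mathcal L_{\rm sec}^{(k)}$ for every $1\le k<D$. 2. $v_{\theta^*}(x,t,1)=\mathbb E[x_1-x_0\mid x_t=x]$ for a.e. $t\in[0,1]$ and $p_t$-a.e. $x$. 3. $v_{\theta^*}(\cdot,\cdot,1)$ generates the marginal path $(p_t)_{t\in[0,1]}$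 from $p_0$ to $p_1$: the integrability $\int_0^1\!\int\|v_{\theta^*}(x,t,1)\|\,dp_t(x)\,dt<\infty$ holds and, weakly on $[0,1]$ with initial value $p_0$, $\partial_t p_t+\nabla\!\cdot(p_t\,v_{\theta^*}(\cdot,t,1))=0$, i.e. $\int\varphi\,dp_t-\int\varphi\,dp_0=\int_0^t\!\int\nabla\varphi(x)\cdot v_{\theta^*}(x,s,1)\,dp_s(x)\,ds$ for all $\varphi\in C_c^\infty(\mathbb R^d)$ and all $t\in[0,1]$. If moreover $v_{\theta^*}(\cdot,t,1)$ is Lipschitz uniformly in $t\in[0,1]$, then the ODE $\dot\psi_t=v_{\theta^*}(\psi_t,t,1)$ (in integral form) has a unique solution on $[0,1]$ from each starting point, and its flow pushes $p_0$ forward to $p_t$ for every $t\in[0,1]$. 4. For every $1\le k<D$, $v_{\theta^*}(x,t/\alpha^k,\alpha^k)=\alpha^k v_{\theta^*}(x,t,1)$ for a.e. $t\in[0,1]$, a.e. $\alpha\in[t,1]$ and $p_t$-a.e. $x$; in particular (for $k=1$) $v_{\theta^*}(x,\tau,\alpha)=\alpha v_{\theta^*}(x,t,1)$ with $\tau=t/\alpha$.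 Hence $\mathcal L^{(k)}_{\rm cons}(v_{\theta^*})=0$ for every $1\le k<D$. 5. If $v_{\theta^*}$ is continuous on $\mathbb R^d\times[0,1]\times(0,1]$, then the identity in 2 holds for every $t\in[0,1]$ and $p_t$-a.e. $x$, and $v_{\theta^*}(x,\tau,\alpha)=\alpha v_{\theta^*}(x,t,1)$ with $\tau=t/\alpha$ holds for every $\alpha\in(0,1]$, every $t\in[0,\alpha]$ and every $x$ in the support of $p_t$. -/

import Mathlib

open MeasureTheory ProbabilityTheory Set
open scoped ENNReal NNReal

namespace RecFM

noncomputable section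

/-- The state space `ℝ^d` with its Euclidean norm. -/
abbrev Vec (d : ℕ) : Type := EuclideanSpace ℝ (Fin d)

/-- A velocity field `v (x, t, α)`, conditioned on position, time and scale. -/
abbrev VelocityField (d : ℕ) : Type := Vec d × ℝ × ℝ → Vec d

/-- The uniform distribution on the interval `[a, b]`. -/
def uniformLaw (a b : ℝ) : Measure ℝ := ProbabilityTheory.cond volume (Icc a b)

/-- The linear interpolant `x_t = (1 - t) x₀ + t x₁`. -/
def interpolant {d : ℕ} {Ω : Type*} (X₀ X₁ : Ω → Vec d) (t : ℝ) : Ω → Vec d :=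
  fun ω => (1 - t) • X₀ ω + t • X₁ ω

/-- The ground-truth velocity `v* = x₁ - x₀`. -/
def targetVelocity {d : ℕ} {Ω : Type*} (X₀ X₁ : Ω → Vec d) : Ω → Vec d :=
  fun ω => X₁ ω - X₀ ω

section Losses

variable {d : ℕ} {Ω : Type*} [MeasurableSpace Ω] (P : Measure Ω) (X₀ X₁ : Ω → Vec d)

/-- The marginal path: `p_t` is the law of `x_t`. -/
def marginalPath (t : ℝ) : Measure (Vec d) := P.map (interpolant X₀ X₁ t)

/-- `E[x₁ - x₀ | x_t = x]`: the mean of the regular conditional distribution of `x₁ - x₀` given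
`x_t = x`. -/
def conditionalVelocity [IsFiniteMeasure P] (t : ℝ) (x : Vec d) : Vec d :=
  ∫ y, y ∂(condDistrib (targetVelocity X₀ X₁) (interpolant X₀ X₁ t) P x)

/-- The primary loss `E ‖v(x_t, t, 1) - v*‖²` with `t ∼ U(0,1)`. -/
def primaryLoss (v : VelocityField d) : ℝ≥0∞ :=
  ∫⁻ t, ∫⁻ ω, ‖v (interpolant X₀ X₁ t ω, t, 1) - targetVelocity X₀ X₁ ω‖ₑ ^ 2 ∂P
    ∂(uniformLaw 0 1)

/-- The loss of the `k`-th secondary trajectory, at scale `α^k` and rescaled time `t / α^k`: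
`E ‖v(x_t, t / α^k, α^k) - α^k v*‖²` with `t ∼ U(0,1)` and `α ∼ U(t,1)`. -/
def secondaryLoss (k : ℕ) (v : VelocityField d) : ℝ≥0∞ :=
  ∫⁻ t, ∫⁻ a, ∫⁻ ω,
      ‖v (interpolant X₀ X₁ t ω, t / a ^ k, a ^ k) - a ^ k • targetVelocity X₀ X₁ ω‖ₑ ^ 2
    ∂P ∂(uniformLaw t 1) ∂(uniformLaw 0 1)

/-- The consistency loss `E ‖v(x_t, t / α^k, α^k) - α^k v(x_t, t, 1)‖²` between the `k`-th
secondary trajectory and the primary one, with `t ∼ U(0,1)` and `α ∼ U(t,1)`. -/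
def consistencyLoss (k : ℕ) (v : VelocityField d) : ℝ≥0∞ :=
  ∫⁻ t, ∫⁻ a, ∫⁻ ω,
      ‖v (interpolant X₀ X₁ t ω, t / a ^ k, a ^ k)
        - a ^ k • v (interpolant X₀ X₁ t ω, t, 1)‖ₑ ^ 2
    ∂P ∂(uniformLaw t 1) ∂(uniformLaw 0 1)

/-- The total loss with recursion depth `D` (one primary trajectory and the `D - 1` secondary
trajectories `k = 1, …, D - 1`) and consistency weight `lam`. -/
def totalLoss (D : ℕ) (lam : ℝ≥0) (v : VelocityField d) : ℝ≥0∞ :=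
  primaryLoss P X₀ X₁ v + ∑ k ∈ Finset.Ico 1 D, secondaryLoss P X₀ X₁ k v
    + (lam : ℝ≥0∞) * ∑ k ∈ Finset.Ico 1 D, consistencyLoss P X₀ X₁ k v

end Losses

/-- `v` minimizes the loss `L` among all measurable velocity fields. -/
def MinimizesLoss {d : ℕ} (L : VelocityField d → ℝ≥0∞) (v : VelocityField d) : Prop :=
  ∀ w : VelocityField d, Measurable w → L v ≤ L w

/-- A class `(v_θ)` is expressive enough for the loss `L` if restricting to it does not raise the
infimum of `L`, compared with all measurable velocity fields. -/
def ExpressiveFor {d : ℕ} {Θ : Type*} (L : VelocityField d → ℝ≥0∞) (v : Θ → VelocityField d) :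
    Prop :=
  ∀ w : VelocityField d, Measurable w → ⨅ θ, L (v θ) ≤ L w

/-- The path `p` on `[0,1]` solves the continuity equation `∂_t p_t + div (p_t u_t) = 0` with
initial value `p_0`, weakly, and with `u` integrable along the path. -/
def SolvesContinuityEquation {d : ℕ} (u : Vec d → ℝ → Vec d) (p : ℝ → Measure (Vec d)) : Prop :=
  (∀ᵐ s ∂(volume.restrict (Icc (0 : ℝ) 1)), Integrable (fun x => u x s) (p s)) ∧
  IntegrableOn (fun s => ∫ x, ‖u x s‖ ∂(p s)) (Icc (0 : ℝ) 1) ∧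
  ∀ φ : Vec d → ℝ, ContDiff ℝ (⊤ : ℕ∞) φ → HasCompactSupport φ →
    IntegrableOn (fun s => ∫ x, fderiv ℝ φ x (u x s) ∂(p s)) (Icc (0 : ℝ) 1) ∧
    ∀ t ∈ Icc (0 : ℝ) 1,
      ∫ x, φ x ∂(p t) - ∫ x, φ x ∂(p 0) = ∫ s in (0 : ℝ)..t, ∫ x, fderiv ℝ φ x (u x s) ∂(p s)

/-- `y` solves `dy/dt = u(y, t)`, `y(0) = x` on `[0,1]`, in the integral (Carathéodory) sense. -/
def IsODESolution {d : ℕ} (u : Vec d → ℝ → Vec d) (x : Vec d) (y : ℝ → Vec d) : Prop :=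
  IntervalIntegrable (fun s => u (y s) s) volume 0 1 ∧
  ∀ t ∈ Icc (0 : ℝ) 1, y t = x + ∫ s in (0 : ℝ)..t, u (y s) s

/-- The field `u` generates the path `p` from `p₀`: the ODE `dψ/dt = u(ψ, t)` has on `[0,1]` a
unique solution `ψ_t(x)` from each starting point `x`, and `ψ_t` pushes `p₀` forward to `p_t` for
every `t ∈ [0,1]`. -/
def GeneratesPath {d : ℕ} (u : Vec d → ℝ → Vec d) (p₀ : Measure (Vec d))
    (p : ℝ → Measure (Vec d)) : Prop :=
  ∃ ψ : ℝ → Vec d → Vec d,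
    (∀ x, IsODESolution u x (fun t => ψ t x)) ∧
    (∀ x y, IsODESolution u x y → EqOn y (fun t => ψ t x) (Icc 0 1)) ∧
    ∀ t ∈ Icc (0 : ℝ) 1, Measurable (ψ t) ∧ p₀.map (ψ t) = p t

end

end RecFM

/-! For fixed time and scale each regression loss is a least-squares problem:
`lintegral_enorm_sq_sub` splits it at the conditional mean of the target given x_t into an excess,
which sees the field, and a residual, which does not. The residuals are finite because the target
velocity is square integrable, and one measurable field, α g(τα, x) with g a jointly measurable
version of the conditional velocity, makes every excess and every consistency loss vanish
(`exists_common_minimizer`). So the terms do not compete: the minimum of the total loss is the sum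
of the separate minima, and a minimizer has zero excess in each term. The a.e. identities and the
vanishing consistency losses follow.

The continuity equation is the fundamental theorem of calculus along each segment t ↦ x_t, averaged;
a gradient evaluated at x_t cannot tell the target velocity from its conditional mean.

The flow is treated without uniqueness theory for the continuity equation. For f bounded Lipschitz
and ψ the flow, put h_t = f ∘ ψ_{t,T}; the claim is that E h_t(x_t) agrees at t = 0 and t = T. Since
h_t is only Lipschitz, it is mollified at scale ε. Over a step δ,
`IsFlow.exists_abs_integral_sub_le` compares segment and flow up to C_ε δ², and
`IsFlow.norm_translate_sub_le` bounds the cost of moving the mollifier through the flow by a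
multiple of ε δ. Summing, then δ → 0 and afterwards ε → 0, gives `IsFlow.integral_comp_eq`.

For a continuous field the identities, in integrated form, are continuous in time and scale, so they
extend from a set of full measure, which is dense. -/

namespace RecFM

open Filter Topology

/-! ### Conditional means and the least-squares splitting. -/

section ConditionalMean

variable {d : ℕ} {Ω : Type*} [MeasurableSpace Ω] {P : Measure Ω} [IsProbabilityMeasure P]
  {X Y : Ω → Vec d}

theorem measurable_clm_apply {α : Type*} [MeasurableSpace α] {ℓ : α → Vec d →L[ℝ] ℝ}
    {y : α → Vec d} (hℓ : Measurable ℓ) (hy : Measurable y) : Measurable fun a => ℓ a (y a) :=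
  (isBoundedBilinearMap_apply (𝕜 := ℝ) (E := Vec d) (F := ℝ)).continuous.measurable.comp
    (hℓ.prodMk hy)

/-- The mean of the conditional distribution of `Y` given `X = x`. -/
noncomputable def condMean (P : Measure Ω) [IsFiniteMeasure P] (X Y : Ω → Vec d) (x : Vec d) :
    Vec d :=
  ∫ y, y ∂(condDistrib Y X P x)

theorem measurable_condMean : Measurable (condMean P X Y) := by
  have : StronglyMeasurable (condMean P X Y) :=
    StronglyMeasurable.integral_kernel_prod_right' (κ := condDistrib Y X P)
      (f := fun p : Vec d × Vec d => p.2) measurable_snd.stronglyMeasurable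
  exact this.measurable

theorem condExp_ae_eq_condMean (hX : Measurable X) (hY : Integrable Y P) :
    P[Y | MeasurableSpace.comap X inferInstance] =ᵐ[P] fun ω => condMean P X Y (X ω) :=
  condExp_ae_eq_integral_condDistrib' hX hY

theorem memLp_condMean (hX : Measurable X) (hY : MemLp Y 2 P) :
    MemLp (fun ω => condMean P X Y (X ω)) 2 P :=
  (memLp_congr_ae (condExp_ae_eq_condMean hX (hY.integrable one_le_two))).1
    (hY.condExp one_le_two)

/-- Conditioning on `X` freezes the functional `ℓ (X ω)`, and a continuous linear functional
commutes with the integral against the conditional law. Only integrability of the pairing is asked,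
so that both bounded gradients and unbounded square-integrable fields are covered. -/
theorem integral_clm_condMean (hX : Measurable X) (hYm : Measurable Y) (hY : Integrable Y P)
    {ℓ : Vec d → Vec d →L[ℝ] ℝ} (hℓ : Measurable ℓ)
    (hint : Integrable (fun ω => ℓ (X ω) (Y ω)) P) :
    ∫ ω, ℓ (X ω) (Y ω) ∂P = ∫ ω, ℓ (X ω) (condMean P X Y (X ω)) ∂P := by
  have hF : Measurable fun p : Vec d × Vec d => ℓ p.1 p.2 :=
    measurable_clm_apply (hℓ.comp measurable_fst) measurable_snd
  have hFi : Integrable (fun p : Vec d × Vec d => ℓ p.1 p.2) (P.map fun ω => (X ω, Y ω)) :=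
    (integrable_map_measure hF.aestronglyMeasurable (hX.prodMk hYm).aemeasurable).2 hint
  have h1 := condExp_prod_ae_eq_integral_condDistrib' hX hYm.aemeasurable hFi
  have hm : MeasurableSpace.comap X inferInstance ≤ (inferInstance : MeasurableSpace Ω) :=
    hX.comap_le
  rw [← integral_condExp hm (f := fun ω => ℓ (X ω) (Y ω))]
  refine integral_congr_ae (h1.trans ?_)
  have hYi : Integrable (fun p : Vec d × Vec d => p.2) (P.map fun ω => (X ω, Y ω)) :=
    (integrable_map_measure measurable_snd.aestronglyMeasurable
      (hX.prodMk hYm).aemeasurable).2 hY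
  filter_upwards [hYi.condDistrib_ae hX.aemeasurable hYm.aemeasurable] with ω hω
  exact (ℓ (X ω)).integral_comp_comm hω

omit [IsProbabilityMeasure P] in
theorem lintegral_enorm_sq_eq_ofReal {f : Ω → Vec d} (hf : MemLp f 2 P) :
    ∫⁻ ω, ‖f ω‖ₑ ^ 2 ∂P = ENNReal.ofReal (∫ ω, ‖f ω‖ ^ 2 ∂P) := by
  rw [ofReal_integral_eq_lintegral_ofReal ((memLp_two_iff_integrable_sq_norm hf.1).1 hf)
    (ae_of_all _ fun ω => by positivity)]
  refine lintegral_congr fun ω => ?_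
  rw [ENNReal.ofReal_pow (norm_nonneg _), ofReal_norm]

omit [IsProbabilityMeasure P] in
theorem memLp_two_iff_lintegral_enorm_sq {f : Ω → Vec d} (hf : AEStronglyMeasurable f P) :
    MemLp f 2 P ↔ ∫⁻ ω, ‖f ω‖ₑ ^ 2 ∂P < ∞ := by
  rw [MemLp, and_iff_right hf,
    eLpNorm_lt_top_iff_lintegral_rpow_enorm_lt_top two_ne_zero ENNReal.ofNat_ne_top]
  simp

omit [IsProbabilityMeasure P] in
theorem integrable_inner_of_memLp {f g : Ω → Vec d} (hf : MemLp f 2 P) (hg : MemLp g 2 P) :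
    Integrable (fun ω => inner ℝ (f ω) (g ω)) P := by
  refine Integrable.mono' (((memLp_two_iff_integrable_sq_norm hf.1).1 hf).add
    ((memLp_two_iff_integrable_sq_norm hg.1).1 hg)) (hf.1.inner hg.1) (ae_of_all _ fun ω => ?_)
  have h1 := norm_inner_le_norm (𝕜 := ℝ) (f ω) (g ω)
  simp only [Pi.add_apply]
  nlinarith [sq_nonneg (‖f ω‖ - ‖g ω‖), sq_nonneg ‖f ω‖, sq_nonneg ‖g ω‖]

theorem integral_inner_condMean (hX : Measurable X) (hYm : Measurable Y) (hY : MemLp Y 2 P)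
    {a : Vec d → Vec d} (ha : Measurable a) (haX : MemLp (fun ω => a (X ω)) 2 P) :
    ∫ ω, inner ℝ (a (X ω)) (Y ω) ∂P = ∫ ω, inner ℝ (a (X ω)) (condMean P X Y (X ω)) ∂P :=
  integral_clm_condMean hX hYm (hY.integrable one_le_two)
    (ℓ := fun x => innerSL ℝ (a x)) ((innerSL ℝ).continuous.measurable.comp ha)
    (integrable_inner_of_memLp haX hY)

/-- The squared distance of `h(X)` to `c Y` splits at the conditional mean. -/
theorem lintegral_enorm_sq_sub (hX : Measurable X) (hYm : Measurable Y) (hY : MemLp Y 2 P)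
    {h : Vec d → Vec d} (hh : Measurable h) (c : ℝ) :
    ∫⁻ ω, ‖h (X ω) - c • Y ω‖ₑ ^ 2 ∂P =
      ∫⁻ ω, ‖h (X ω) - c • condMean P X Y (X ω)‖ₑ ^ 2 ∂P +
        ∫⁻ ω, ‖c • condMean P X Y (X ω) - c • Y ω‖ₑ ^ 2 ∂P := by
  have hg := memLp_condMean hX hY
  have hgm : Measurable fun ω => condMean P X Y (X ω) := measurable_condMean.comp hX
  have hhX : Measurable fun ω => h (X ω) := hh.comp hX
  by_cases hL : MemLp (fun ω => h (X ω)) 2 P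
  · have h1 : MemLp (fun ω => h (X ω) - c • Y ω) 2 P := hL.sub (hY.const_smul c)
    have h2 : MemLp (fun ω => h (X ω) - c • condMean P X Y (X ω)) 2 P :=
      hL.sub (hg.const_smul c)
    have h3 : MemLp (fun ω => c • condMean P X Y (X ω) - c • Y ω) 2 P :=
      (hg.const_smul c).sub (hY.const_smul c)
    rw [lintegral_enorm_sq_eq_ofReal h1, lintegral_enorm_sq_eq_ofReal h2,
      lintegral_enorm_sq_eq_ofReal h3,
      ← ENNReal.ofReal_add (integral_nonneg fun _ => by positivity)
        (integral_nonneg fun _ => by positivity)]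
    congr 1
    have e2 := (memLp_two_iff_integrable_sq_norm h2.1).1 h2
    have e3 := (memLp_two_iff_integrable_sq_norm h3.1).1 h3
    -- The cross term vanishes: `Y` minus its conditional mean is orthogonal to square-integrable
    -- functions of `X`.
    have horth : ∫ ω, inner ℝ (h (X ω) - c • condMean P X Y (X ω))
        (c • condMean P X Y (X ω) - c • Y ω) ∂P = 0 := by
      have hm : Measurable fun x => h x - c • condMean P X Y x :=
        hh.sub (measurable_condMean.const_smul c)
      have := integral_inner_condMean hX hYm hY (a := fun x => h x - c • condMean P X Y x) hm h2
      simp_rw [inner_sub_right, inner_smul_right]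
      rw [integral_sub, integral_const_mul, integral_const_mul, this, sub_self]
      · exact (integrable_inner_of_memLp h2 hg).const_mul c
      · exact (integrable_inner_of_memLp h2 hY).const_mul c
    have hexp : ∀ ω, ‖h (X ω) - c • Y ω‖ ^ 2 =
        ‖h (X ω) - c • condMean P X Y (X ω)‖ ^ 2 +
          2 * inner ℝ (h (X ω) - c • condMean P X Y (X ω))
            (c • condMean P X Y (X ω) - c • Y ω) +
          ‖c • condMean P X Y (X ω) - c • Y ω‖ ^ 2 := fun ω => by
      rw [← norm_add_sq_real, sub_add_sub_cancel]
    have ei := (integrable_inner_of_memLp h2 h3).const_mul 2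
    have e2i : Integrable (fun ω => ‖h (X ω) - c • condMean P X Y (X ω)‖ ^ 2 +
        2 * inner ℝ (h (X ω) - c • condMean P X Y (X ω))
          (c • condMean P X Y (X ω) - c • Y ω)) P := e2.add ei
    simp_rw [hexp]
    rw [integral_add e2i e3, integral_add e2 ei, integral_const_mul, horth]
    ring
  -- If `h(X)` is not square integrable, both sides are infinite, so the splitting needs no
  -- integrability of `h`.
  · have h1 : ¬ MemLp (fun ω => h (X ω) - c • Y ω) 2 P := fun H =>
      hL ((memLp_congr_ae (ae_of_all _ fun ω => by simp)).1 (H.add (hY.const_smul c)))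
    have h2 : ¬ MemLp (fun ω => h (X ω) - c • condMean P X Y (X ω)) 2 P := fun H =>
      hL ((memLp_congr_ae (ae_of_all _ fun ω => by simp)).1 (H.add (hg.const_smul c)))
    rw [memLp_two_iff_lintegral_enorm_sq (by fun_prop), not_lt, top_le_iff] at h1 h2
    rw [h1, h2, top_add]

/-- The splitting with `h = 0` and `c = 1`. Applied to x_t, it bounds the velocity in L² uniformly
in time. -/
theorem integral_sq_norm_condMean_le (hX : Measurable X) (hYm : Measurable Y) (hY : MemLp Y 2 P) :
    ∫ ω, ‖condMean P X Y (X ω)‖ ^ 2 ∂P ≤ ∫ ω, ‖Y ω‖ ^ 2 ∂P := by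
  have h := lintegral_enorm_sq_sub hX hYm hY (h := fun _ => 0) measurable_const 1
  have hg := memLp_condMean hX hY
  simp only [one_smul, zero_sub, enorm_neg] at h
  rw [lintegral_enorm_sq_eq_ofReal hY, lintegral_enorm_sq_eq_ofReal hg] at h
  refine (ENNReal.ofReal_le_ofReal_iff (integral_nonneg fun _ => by positivity)).1 ?_
  rw [h]
  exact le_self_add

end ConditionalMean

/-! ### The interpolant and joint measurability of the conditional velocity. -/

section Interpolant

variable {d : ℕ} {Ω : Type*} [MeasurableSpace Ω] {P : Measure Ω} [IsProbabilityMeasure P]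
  {X₀ X₁ : Ω → Vec d}

theorem conditionalVelocity_eq_condMean (t : ℝ) :
    conditionalVelocity P X₀ X₁ t =
      condMean P (interpolant X₀ X₁ t) (targetVelocity X₀ X₁) := rfl

omit [MeasurableSpace Ω] in
theorem interpolant_eq (t : ℝ) (ω : Ω) :
    interpolant X₀ X₁ t ω = X₀ ω + t • targetVelocity X₀ X₁ ω := by
  simp only [interpolant, targetVelocity]; module

theorem measurable_interpolant_uncurry (hX₀ : Measurable X₀) (hX₁ : Measurable X₁) :
    Measurable fun p : ℝ × Ω => interpolant X₀ X₁ p.1 p.2 := by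
  unfold interpolant; fun_prop

theorem measurable_interpolant (hX₀ : Measurable X₀) (hX₁ : Measurable X₁) (t : ℝ) :
    Measurable (interpolant X₀ X₁ t) := by
  unfold interpolant; fun_prop

theorem measurable_targetVelocity (hX₀ : Measurable X₀) (hX₁ : Measurable X₁) :
    Measurable (targetVelocity X₀ X₁) := by
  unfold targetVelocity; fun_prop

/-- The conditional velocity has a version that is jointly measurable in time and position. -/
theorem exists_measurable_conditionalVelocity (hX₀ : Measurable X₀) (hX₁ : Measurable X₁) :
    ∃ G : ℝ × Vec d → Vec d, Measurable G ∧
      ∀ t, ∀ᵐ x ∂(marginalPath P X₀ X₁ t), G (t, x) = conditionalVelocity P X₀ X₁ t x := by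
  have hJ : Measurable fun p : ℝ × Ω => (interpolant X₀ X₁ p.1 p.2, targetVelocity X₀ X₁ p.2) :=
    (measurable_interpolant_uncurry hX₀ hX₁).prodMk
      ((measurable_targetVelocity hX₀ hX₁).comp measurable_snd)
  -- Separate conditional distributions for each t carry no measurability in t. Disintegrating the
  -- joint law of (x_t, v*) as a kernel with parameter t gives a conditional kernel measurable in
  -- (t, x).
  let κ : Kernel ℝ (Vec d × Vec d) :=
    Kernel.map (Kernel.id ×ₖ Kernel.const ℝ P) fun p : ℝ × Ω =>
      (interpolant X₀ X₁ p.1 p.2, targetVelocity X₀ X₁ p.2)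
  have hκ : ∀ t, κ t = P.map fun ω => (interpolant X₀ X₁ t ω, targetVelocity X₀ X₁ ω) := by
    intro t
    simp only [κ]
    rw [Kernel.map_apply _ hJ, Kernel.prod_apply, Kernel.id_apply, Kernel.const_apply,
      Measure.dirac_prod, Measure.map_map hJ (by fun_prop)]
    rfl
  have : IsMarkovKernel κ := Kernel.IsMarkovKernel.map _ hJ
  refine ⟨fun p => ∫ y, y ∂(κ.condKernel p), ?_, fun t => ?_⟩
  · exact (StronglyMeasurable.integral_kernel_prod_right' (κ := κ.condKernel)
      (f := fun p : (ℝ × Vec d) × Vec d => p.2) measurable_snd.stronglyMeasurable).measurable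
  · have hX := measurable_interpolant hX₀ hX₁ t
    have hV := measurable_targetVelocity hX₀ hX₁
    have hfst : P.map (interpolant X₀ X₁ t) = κ.fst t := by
      rw [Kernel.fst_apply, hκ, Measure.map_map measurable_fst (hX.prodMk hV)]; rfl
    have hcomp : P.map (fun ω => (interpolant X₀ X₁ t ω, targetVelocity X₀ X₁ ω)) =
        P.map (interpolant X₀ X₁ t) ⊗ₘ (Kernel.sectR κ.condKernel t) := by
      rw [hfst, ← hκ]
      conv_lhs => rw [← κ.disintegrate κ.condKernel]
      rw [Kernel.compProd_apply_eq_compProd_sectR]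
    -- At fixed t both kernels disintegrate the same law, so they agree almost everywhere.
    filter_upwards [condDistrib_ae_eq_of_measure_eq_compProd_of_measurable hX hV hcomp] with x hx
    simp only [conditionalVelocity, hx, Kernel.sectR_apply]

end Interpolant

/-! ### Uniform laws on intervals, including degenerate ones. -/

section UniformLaw

theorem uniformLaw_zero_one : uniformLaw 0 1 = volume.restrict (Icc (0 : ℝ) 1) := by
  simp [uniformLaw, ProbabilityTheory.cond]

theorem uniformLaw_eq (a b : ℝ) :
    uniformLaw a b = (volume (Icc a b))⁻¹ • volume.restrict (Icc a b) := rfl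

/-- The normalizing factor is never zero because the interval has finite length. For length zero the
factor is ∞ and both sides hold vacuously, so `a < b` is not needed. -/
theorem ae_uniformLaw_iff {a b : ℝ} {p : ℝ → Prop} :
    (∀ᵐ x ∂(uniformLaw a b), p x) ↔ ∀ᵐ x ∂(volume.restrict (Icc a b)), p x := by
  rw [uniformLaw_eq, Measure.ae_ennreal_smul_measure_iff]
  simp [Real.volume_Icc]

theorem lintegral_uniformLaw (a b : ℝ) (f : ℝ → ℝ≥0∞) :
    ∫⁻ x, f x ∂(uniformLaw a b) = (volume (Icc a b))⁻¹ * ∫⁻ x in Icc a b, f x := by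
  rw [uniformLaw_eq, lintegral_smul_measure, smul_eq_mul]

theorem uniformLaw_univ_le (a b : ℝ) : uniformLaw a b univ ≤ 1 := by
  rw [uniformLaw_eq, Measure.smul_apply, Measure.restrict_apply_univ, smul_eq_mul]
  exact ENNReal.inv_mul_le_one _

/-- The domain of integration moves with `t`; an indicator of the closed region t ≤ a ≤ b turns the
integral into one over a fixed space. -/
theorem measurable_lintegral_uniformLaw {F : ℝ × ℝ → ℝ≥0∞} (hF : Measurable F) (b : ℝ) :
    Measurable fun t => ∫⁻ a, F (t, a) ∂(uniformLaw t b) := by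
  simp_rw [lintegral_uniformLaw, Real.volume_Icc]
  refine Measurable.mul (by fun_prop) ?_
  have hS : MeasurableSet {p : ℝ × ℝ | p.2 ∈ Icc p.1 b} := by
    have : {p : ℝ × ℝ | p.2 ∈ Icc p.1 b} = {p | p.1 ≤ p.2} ∩ {p | p.2 ≤ b} := rfl
    rw [this]
    exact (measurableSet_le measurable_fst measurable_snd).inter
      (measurableSet_le measurable_snd measurable_const)
  have : (fun t => ∫⁻ a in Icc t b, F (t, a)) =
      fun t => ∫⁻ a, {p : ℝ × ℝ | p.2 ∈ Icc p.1 b}.indicator F (t, a) := by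
    funext t
    rw [← lintegral_indicator measurableSet_Icc]
    rfl
  rw [this]
  exact (hF.indicator hS).lintegral_prod_right'

theorem ae_restrict_Icc_mem_Ioo (a b : ℝ) :
    ∀ᵐ t ∂(volume.restrict (Icc a b)), t ∈ Ioo a b := by
  rw [← restrict_Ioo_eq_restrict_Icc]
  exact ae_restrict_mem measurableSet_Ioo

end UniformLaw

/-! ### Excess and residual of the losses, and their common minimizer. -/

section Losses

variable {d : ℕ} {Ω : Type*} [MeasurableSpace Ω] (P : Measure Ω) [IsProbabilityMeasure P]
  (X₀ X₁ : Ω → Vec d)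

/-- The mean squared fluctuation of `c v*` around its conditional mean given `x_t`. -/
noncomputable def residual (t c : ℝ) : ℝ≥0∞ :=
  ∫⁻ ω, ‖c • conditionalVelocity P X₀ X₁ t (interpolant X₀ X₁ t ω)
    - c • targetVelocity X₀ X₁ ω‖ₑ ^ 2 ∂P

/-- The primary loss in excess of its minimum. -/
noncomputable def primaryExcess (v : VelocityField d) : ℝ≥0∞ :=
  ∫⁻ t, ∫⁻ ω, ‖v (interpolant X₀ X₁ t ω, t, 1)
    - conditionalVelocity P X₀ X₁ t (interpolant X₀ X₁ t ω)‖ₑ ^ 2 ∂P ∂(uniformLaw 0 1)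

/-- The secondary loss in excess of its minimum. -/
noncomputable def secondaryExcess (k : ℕ) (v : VelocityField d) : ℝ≥0∞ :=
  ∫⁻ t, ∫⁻ a, ∫⁻ ω, ‖v (interpolant X₀ X₁ t ω, t / a ^ k, a ^ k)
    - a ^ k • conditionalVelocity P X₀ X₁ t (interpolant X₀ X₁ t ω)‖ₑ ^ 2
    ∂P ∂(uniformLaw t 1) ∂(uniformLaw 0 1)

/-- The minimum of the primary loss. -/
noncomputable def primaryMin : ℝ≥0∞ := ∫⁻ t, residual P X₀ X₁ t 1 ∂(uniformLaw 0 1)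

/-- The minimum of the secondary loss. -/
noncomputable def secondaryMin (k : ℕ) : ℝ≥0∞ :=
  ∫⁻ t, ∫⁻ a, residual P X₀ X₁ t (a ^ k) ∂(uniformLaw t 1) ∂(uniformLaw 0 1)

variable {P X₀ X₁}

theorem residual_smul (t c : ℝ) :
    residual P X₀ X₁ t c = ‖c‖ₑ ^ 2 * residual P X₀ X₁ t 1 := by
  unfold residual
  rw [← lintegral_const_mul' _ _ (by simp)]
  refine lintegral_congr fun ω => ?_
  rw [← smul_sub, enorm_smul, mul_pow, one_smul, one_smul]

theorem residual_one_le (hX₀ : Measurable X₀) (hX₁ : Measurable X₁)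
    (hL2 : MemLp (targetVelocity X₀ X₁) 2 P) (t : ℝ) :
    residual P X₀ X₁ t 1 ≤ ∫⁻ ω, ‖targetVelocity X₀ X₁ ω‖ₑ ^ 2 ∂P := by
  have h := lintegral_enorm_sq_sub (measurable_interpolant hX₀ hX₁ t)
    (measurable_targetVelocity hX₀ hX₁) hL2 (h := fun _ => 0) measurable_const 1
  simp only [one_smul, zero_sub, enorm_neg] at h
  rw [h]
  simp only [residual, one_smul, conditionalVelocity_eq_condMean]
  exact le_add_self

/-- The measurable integrand of the excess losses, in terms of a jointly measurable version of
the conditional velocity. -/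
theorem exists_excess_integrand (hX₀ : Measurable X₀) (hX₁ : Measurable X₁)
    {v : VelocityField d} (hv : Measurable v) :
    ∃ F : ℝ × ℝ × ℝ → ℝ≥0∞, Measurable F ∧ ∀ t τ α,
      F (t, τ, α) = ∫⁻ ω, ‖v (interpolant X₀ X₁ t ω, τ, α)
        - α • conditionalVelocity P X₀ X₁ t (interpolant X₀ X₁ t ω)‖ₑ ^ 2 ∂P := by
  obtain ⟨G, hG, hGe⟩ := exists_measurable_conditionalVelocity (P := P) hX₀ hX₁
  have hI := measurable_interpolant_uncurry hX₀ hX₁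
  refine ⟨fun p => ∫⁻ ω, ‖v (interpolant X₀ X₁ p.1 ω, p.2.1, p.2.2)
        - p.2.2 • G (p.1, interpolant X₀ X₁ p.1 ω)‖ₑ ^ 2 ∂P, ?_, fun t τ α => ?_⟩
  · have h1 : Measurable fun q : (ℝ × ℝ × ℝ) × Ω => interpolant X₀ X₁ q.1.1 q.2 :=
      hI.comp ((measurable_fst.comp measurable_fst).prodMk measurable_snd)
    have h2 : Measurable fun q : (ℝ × ℝ × ℝ) × Ω =>
        ‖v (interpolant X₀ X₁ q.1.1 q.2, q.1.2.1, q.1.2.2)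
        - q.1.2.2 • G (q.1.1, interpolant X₀ X₁ q.1.1 q.2)‖ₑ ^ 2 := by
      have h3 := hv.comp (h1.prodMk (measurable_snd.comp measurable_fst))
      have h4 := hG.comp ((measurable_fst.comp measurable_fst).prodMk h1)
      exact ((h3.sub ((measurable_snd.comp (measurable_snd.comp measurable_fst)).smul
        h4)).enorm).pow_const 2
    exact h2.lintegral_prod_right'
  · refine lintegral_congr_ae ?_
    filter_upwards [ae_of_ae_map (measurable_interpolant hX₀ hX₁ t).aemeasurable (hGe t)]
      with ω hω
    simp only [hω]

theorem lintegral_excess_eq_zero_iff (hX₀ : Measurable X₀) (hX₁ : Measurable X₁)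
    {v : VelocityField d} (hv : Measurable v) (t τ α : ℝ) :
    ∫⁻ ω, ‖v (interpolant X₀ X₁ t ω, τ, α)
        - α • conditionalVelocity P X₀ X₁ t (interpolant X₀ X₁ t ω)‖ₑ ^ 2 ∂P = 0 ↔
      ∀ᵐ x ∂(marginalPath P X₀ X₁ t), v (x, τ, α) = α • conditionalVelocity P X₀ X₁ t x := by
  have hX := measurable_interpolant hX₀ hX₁ t
  have hg : Measurable (conditionalVelocity P X₀ X₁ t) := measurable_condMean
  have hvt : Measurable fun x => v (x, τ, α) := hv.comp (by fun_prop)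
  have hm : Measurable fun ω => ‖v (interpolant X₀ X₁ t ω, τ, α)
      - α • conditionalVelocity P X₀ X₁ t (interpolant X₀ X₁ t ω)‖ₑ ^ 2 :=
    ((hvt.comp hX).sub ((hg.comp hX).const_smul α)).enorm.pow_const 2
  have hset : MeasurableSet {x | v (x, τ, α) = α • conditionalVelocity P X₀ X₁ t x} :=
    measurableSet_eq_fun hvt (hg.const_smul α)
  rw [lintegral_eq_zero_iff hm, marginalPath, ae_map_iff hX.aemeasurable hset]
  refine eventually_congr (ae_of_all _ fun ω => ?_)
  simp [sub_eq_zero]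

/-- The splitting integrated over time. Additivity of the integral needs measurability of one
summand only; the excess is chosen, for which `exists_excess_integrand` provides a measurable form.
-/
theorem primaryLoss_eq (hX₀ : Measurable X₀) (hX₁ : Measurable X₁)
    (hL2 : MemLp (targetVelocity X₀ X₁) 2 P) {v : VelocityField d} (hv : Measurable v) :
    primaryLoss P X₀ X₁ v = primaryExcess P X₀ X₁ v + primaryMin P X₀ X₁ := by
  obtain ⟨F, hF, hFe⟩ := exists_excess_integrand (P := P) hX₀ hX₁ hv
  unfold primaryLoss primaryExcess primaryMin
  rw [← lintegral_add_left]
  · refine lintegral_congr fun t => ?_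
    have := lintegral_enorm_sq_sub (measurable_interpolant hX₀ hX₁ t)
      (measurable_targetVelocity hX₀ hX₁) hL2 (h := fun x => v (x, t, 1))
      (hv.comp (by fun_prop)) 1
    simpa [residual, conditionalVelocity_eq_condMean] using this
  · have h1 : Measurable fun t : ℝ => F (t, t, 1) := hF.comp (by fun_prop)
    simpa [hFe] using h1

theorem secondaryLoss_eq (hX₀ : Measurable X₀) (hX₁ : Measurable X₁)
    (hL2 : MemLp (targetVelocity X₀ X₁) 2 P) (k : ℕ) {v : VelocityField d} (hv : Measurable v) :
    secondaryLoss P X₀ X₁ k v = secondaryExcess P X₀ X₁ k v + secondaryMin P X₀ X₁ k := by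
  obtain ⟨F, hF, hFe⟩ := exists_excess_integrand (P := P) hX₀ hX₁ hv
  have hFm : Measurable fun p : ℝ × ℝ => F (p.1, p.1 / p.2 ^ k, p.2 ^ k) :=
    hF.comp (by fun_prop)
  unfold secondaryLoss secondaryExcess secondaryMin
  rw [← lintegral_add_left]
  · refine lintegral_congr fun t => ?_
    rw [← lintegral_add_left]
    · refine lintegral_congr fun a => ?_
      exact lintegral_enorm_sq_sub (measurable_interpolant hX₀ hX₁ t)
        (measurable_targetVelocity hX₀ hX₁) hL2 (h := fun x => v (x, t / a ^ k, a ^ k))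
        (hv.comp (by fun_prop)) (a ^ k)
    · simp_rw [← hFe]
      exact hFm.comp (measurable_const.prodMk measurable_id)
  · simp_rw [← hFe]
    exact measurable_lintegral_uniformLaw hFm 1

/-- Losses take values in [0, ∞]; a finite minimum can be cancelled from both sides of an inequality
between losses. -/
theorem primaryMin_ne_top (hX₀ : Measurable X₀) (hX₁ : Measurable X₁)
    (hL2 : MemLp (targetVelocity X₀ X₁) 2 P) : primaryMin P X₀ X₁ ≠ ∞ := by
  have h := (memLp_two_iff_lintegral_enorm_sq hL2.1).1 hL2
  refine ne_top_of_le_ne_top h.ne ?_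
  calc primaryMin P X₀ X₁
      ≤ ∫⁻ _, (∫⁻ ω, ‖targetVelocity X₀ X₁ ω‖ₑ ^ 2 ∂P) ∂(uniformLaw 0 1) :=
        lintegral_mono fun t => residual_one_le hX₀ hX₁ hL2 t
    _ ≤ _ := by
        rw [lintegral_const]
        exact mul_le_of_le_one_right' (uniformLaw_univ_le 0 1)

theorem secondaryMin_ne_top (hX₀ : Measurable X₀) (hX₁ : Measurable X₁)
    (hL2 : MemLp (targetVelocity X₀ X₁) 2 P) (k : ℕ) : secondaryMin P X₀ X₁ k ≠ ∞ := by
  have h := (memLp_two_iff_lintegral_enorm_sq hL2.1).1 hL2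
  refine ne_top_of_le_ne_top h.ne ?_
  have hin : ∀ᵐ t ∂(uniformLaw 0 1), ∫⁻ a, residual P X₀ X₁ t (a ^ k) ∂(uniformLaw t 1) ≤
      ∫⁻ ω, ‖targetVelocity X₀ X₁ ω‖ₑ ^ 2 ∂P := by
    rw [uniformLaw_zero_one]
    filter_upwards [ae_restrict_Icc_mem_Ioo 0 1] with t ht
    calc ∫⁻ a, residual P X₀ X₁ t (a ^ k) ∂(uniformLaw t 1)
        ≤ ∫⁻ _, (∫⁻ ω, ‖targetVelocity X₀ X₁ ω‖ₑ ^ 2 ∂P) ∂(uniformLaw t 1) := by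
          refine lintegral_mono_ae ?_
          rw [ae_uniformLaw_iff]
          filter_upwards [ae_restrict_mem measurableSet_Icc] with a ha
          rw [residual_smul]
          -- Scales in [t, 1] with t > 0 have absolute value at most 1, so they do not enlarge the
          -- residual.
          refine (mul_le_of_le_one_left' ?_).trans (residual_one_le hX₀ hX₁ hL2 t)
          refine pow_le_one₀ zero_le ?_
          rw [← ofReal_norm, ENNReal.ofReal_le_one, norm_pow]
          refine pow_le_one₀ (norm_nonneg _) ?_
          rw [Real.norm_of_nonneg (ht.1.le.trans ha.1)]
          exact ha.2
      _ ≤ _ := by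
          rw [lintegral_const]
          exact mul_le_of_le_one_right' (uniformLaw_univ_le t 1)
  calc secondaryMin P X₀ X₁ k
      ≤ ∫⁻ _, (∫⁻ ω, ‖targetVelocity X₀ X₁ ω‖ₑ ^ 2 ∂P) ∂(uniformLaw 0 1) :=
        lintegral_mono_ae hin
    _ ≤ _ := by
        rw [lintegral_const]
        exact mul_le_of_le_one_right' (uniformLaw_univ_le 0 1)

theorem primaryExcess_eq_zero_iff (hX₀ : Measurable X₀) (hX₁ : Measurable X₁)
    {v : VelocityField d} (hv : Measurable v) :
    primaryExcess P X₀ X₁ v = 0 ↔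
      ∀ᵐ t ∂(volume.restrict (Icc (0 : ℝ) 1)), ∀ᵐ x ∂(marginalPath P X₀ X₁ t),
        v (x, t, 1) = conditionalVelocity P X₀ X₁ t x := by
  obtain ⟨F, hF, hFe⟩ := exists_excess_integrand (P := P) hX₀ hX₁ hv
  have hm : Measurable fun t => F (t, t, 1) := hF.comp (by fun_prop)
  have h : primaryExcess P X₀ X₁ v = ∫⁻ t, F (t, t, 1) ∂(uniformLaw 0 1) := by
    simp [primaryExcess, hFe]
  rw [h, lintegral_eq_zero_iff hm, uniformLaw_zero_one]
  refine eventually_congr (ae_of_all _ fun t => ?_)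
  have := lintegral_excess_eq_zero_iff (P := P) hX₀ hX₁ hv t t 1
  rw [← hFe] at this
  simpa using this

theorem secondaryExcess_eq_zero_iff (hX₀ : Measurable X₀) (hX₁ : Measurable X₁) (k : ℕ)
    {v : VelocityField d} (hv : Measurable v) :
    secondaryExcess P X₀ X₁ k v = 0 ↔
      ∀ᵐ t ∂(volume.restrict (Icc (0 : ℝ) 1)), ∀ᵐ a ∂(volume.restrict (Icc t 1)),
        ∀ᵐ x ∂(marginalPath P X₀ X₁ t),
          v (x, t / a ^ k, a ^ k) = a ^ k • conditionalVelocity P X₀ X₁ t x := by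
  obtain ⟨F, hF, hFe⟩ := exists_excess_integrand (P := P) hX₀ hX₁ hv
  have hFm : Measurable fun p : ℝ × ℝ => F (p.1, p.1 / p.2 ^ k, p.2 ^ k) :=
    hF.comp (by fun_prop)
  have h : secondaryExcess P X₀ X₁ k v =
      ∫⁻ t, ∫⁻ a, F (t, t / a ^ k, a ^ k) ∂(uniformLaw t 1) ∂(uniformLaw 0 1) := by
    simp [secondaryExcess, hFe]
  rw [h, lintegral_eq_zero_iff (measurable_lintegral_uniformLaw hFm 1), uniformLaw_zero_one]
  refine eventually_congr ?_
  filter_upwards [ae_restrict_Icc_mem_Ioo 0 1] with t ht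
  have hmt : Measurable fun a => F (t, t / a ^ k, a ^ k) :=
    hFm.comp (measurable_const.prodMk measurable_id)
  rw [Pi.zero_apply, lintegral_eq_zero_iff hmt, EventuallyEq, ae_uniformLaw_iff]
  refine eventually_congr (ae_of_all _ fun a => ?_)
  rw [Pi.zero_apply, hFe]
  exact lintegral_excess_eq_zero_iff hX₀ hX₁ hv t _ _

omit [IsProbabilityMeasure P] in
theorem consistencyLoss_eq_zero (hX₀ : Measurable X₀) (hX₁ : Measurable X₁) (k : ℕ)
    {v : VelocityField d}
    (h : ∀ᵐ t ∂(volume.restrict (Icc (0 : ℝ) 1)), ∀ᵐ a ∂(volume.restrict (Icc t 1)),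
      ∀ᵐ x ∂(marginalPath P X₀ X₁ t), v (x, t / a ^ k, a ^ k) = a ^ k • v (x, t, 1)) :
    consistencyLoss P X₀ X₁ k v = 0 := by
  unfold consistencyLoss
  rw [uniformLaw_zero_one]
  refine (lintegral_congr_ae ?_).trans lintegral_zero
  filter_upwards [h, ae_restrict_Icc_mem_Ioo 0 1] with t ht ht1
  refine (lintegral_congr_ae ?_).trans lintegral_zero
  rw [EventuallyEq, ae_uniformLaw_iff]
  filter_upwards [ht] with a ha
  refine (lintegral_congr_ae ?_).trans lintegral_zero
  filter_upwards [ae_of_ae_map (measurable_interpolant hX₀ hX₁ t).aemeasurable ha] with ω hω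
  simp [hω]

/-- One measurable field minimizes the primary loss and all secondary losses at once. -/
theorem exists_common_minimizer (P : Measure Ω) [IsProbabilityMeasure P]
    (hX₀ : Measurable X₀) (hX₁ : Measurable X₁) :
    ∃ w : VelocityField d, Measurable w ∧ primaryExcess P X₀ X₁ w = 0 ∧
      (∀ k, secondaryExcess P X₀ X₁ k w = 0) ∧ ∀ k, consistencyLoss P X₀ X₁ k w = 0 := by
  obtain ⟨G, hG, hGe⟩ := exists_measurable_conditionalVelocity (P := P) hX₀ hX₁
  -- The product of rescaled time t / α^k and scale α^k recovers the primary time t, so a single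
  -- formula serves every k and also the primary trajectory.
  let w : VelocityField d := fun p => p.2.2 • G (p.2.1 * p.2.2, p.1)
  have hw : Measurable w :=
    (measurable_snd.comp measurable_snd).smul (hG.comp (by fun_prop))
  have hscale : ∀ k : ℕ, ∀ᵐ t ∂(volume.restrict (Icc (0 : ℝ) 1)),
      ∀ᵐ a ∂(volume.restrict (Icc t 1)), ∀ x, w (x, t / a ^ k, a ^ k) = a ^ k • G (t, x) := by
    intro k
    filter_upwards [ae_restrict_Icc_mem_Ioo 0 1] with t ht
    filter_upwards [ae_restrict_mem measurableSet_Icc] with a ha x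
    have : a ^ k ≠ 0 := (pow_pos (ht.1.trans_le ha.1) k).ne'
    simp only [w]
    rw [div_mul_cancel₀ _ this]
  refine ⟨w, hw, ?_, fun k => ?_, fun k => ?_⟩
  · rw [primaryExcess_eq_zero_iff hX₀ hX₁ hw]
    refine ae_of_all _ fun t => ?_
    filter_upwards [hGe t] with x hx
    simp [w, hx]
  · rw [secondaryExcess_eq_zero_iff hX₀ hX₁ k hw]
    filter_upwards [hscale k] with t ht
    filter_upwards [ht] with a ha
    filter_upwards [hGe t] with x hx
    rw [ha, hx]
  · refine consistencyLoss_eq_zero hX₀ hX₁ k ?_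
    filter_upwards [hscale k] with t ht
    filter_upwards [ht] with a ha
    refine ae_of_all _ fun x => ?_
    rw [ha]
    simp [w]

theorem minimizesLoss_iff_of_eq_add {L E : VelocityField d → ℝ≥0∞} {m : ℝ≥0∞} (hm : m ≠ ∞)
    (hL : ∀ w, Measurable w → L w = E w + m) (hex : ∃ w, Measurable w ∧ E w = 0)
    {v : VelocityField d} (hv : Measurable v) : MinimizesLoss L v ↔ E v = 0 := by
  constructor
  · intro h
    obtain ⟨w, hw, hw0⟩ := hex
    have := h w hw
    rw [hL v hv, hL w hw, hw0] at this
    have h2 := (ENNReal.add_le_add_iff_right hm).1 this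
    exact le_antisymm h2 zero_le
  · intro h w hw
    rw [hL v hv, hL w hw, h]
    gcongr
    exact zero_le

theorem minimizesLoss_primaryLoss_iff (hX₀ : Measurable X₀) (hX₁ : Measurable X₁)
    (hL2 : MemLp (targetVelocity X₀ X₁) 2 P) {v : VelocityField d} (hv : Measurable v) :
    MinimizesLoss (primaryLoss P X₀ X₁) v ↔ primaryExcess P X₀ X₁ v = 0 := by
  obtain ⟨w, hw, h1, -, -⟩ := exists_common_minimizer P hX₀ hX₁
  exact minimizesLoss_iff_of_eq_add (primaryMin_ne_top hX₀ hX₁ hL2)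
    (fun u hu => primaryLoss_eq hX₀ hX₁ hL2 hu) ⟨w, hw, h1⟩ hv

theorem minimizesLoss_secondaryLoss_iff (hX₀ : Measurable X₀) (hX₁ : Measurable X₁)
    (hL2 : MemLp (targetVelocity X₀ X₁) 2 P) (k : ℕ) {v : VelocityField d} (hv : Measurable v) :
    MinimizesLoss (secondaryLoss P X₀ X₁ k) v ↔ secondaryExcess P X₀ X₁ k v = 0 := by
  obtain ⟨w, hw, -, h2, -⟩ := exists_common_minimizer P hX₀ hX₁
  exact minimizesLoss_iff_of_eq_add (secondaryMin_ne_top hX₀ hX₁ hL2 k)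
    (fun u hu => secondaryLoss_eq hX₀ hX₁ hL2 k hu) ⟨w, hw, h2 k⟩ hv

/-- A field whose total loss is minimal among all measurable fields has no excess loss. -/
theorem excess_eq_zero_of_minimizesLoss_totalLoss (hX₀ : Measurable X₀) (hX₁ : Measurable X₁)
    (hL2 : MemLp (targetVelocity X₀ X₁) 2 P) {D : ℕ} {lam : ℝ≥0} {v : VelocityField d}
    (hv : Measurable v) (hmin : MinimizesLoss (totalLoss P X₀ X₁ D lam) v) :
    primaryExcess P X₀ X₁ v = 0 ∧ ∀ k ∈ Finset.Ico 1 D, secondaryExcess P X₀ X₁ k v = 0 := by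
  obtain ⟨w, hw, h1, h2, h3⟩ := exists_common_minimizer P hX₀ hX₁
  have h := hmin w hw
  have hM : primaryMin P X₀ X₁ + ∑ k ∈ Finset.Ico 1 D, secondaryMin P X₀ X₁ k ≠ ∞ :=
    ENNReal.add_ne_top.2 ⟨primaryMin_ne_top hX₀ hX₁ hL2,
      ENNReal.sum_ne_top.2 fun k _ => secondaryMin_ne_top hX₀ hX₁ hL2 k⟩
  have hlow : primaryExcess P X₀ X₁ v + ∑ k ∈ Finset.Ico 1 D, secondaryExcess P X₀ X₁ k v
      + (primaryMin P X₀ X₁ + ∑ k ∈ Finset.Ico 1 D, secondaryMin P X₀ X₁ k) ≤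
      totalLoss P X₀ X₁ D lam v := by
    unfold totalLoss
    rw [primaryLoss_eq hX₀ hX₁ hL2 hv,
      Finset.sum_congr rfl fun k _ => secondaryLoss_eq hX₀ hX₁ hL2 k hv, Finset.sum_add_distrib]
    -- The weighted consistency terms are nonnegative and are dropped; nothing is lost, as they
    -- vanish at the common minimizer.
    refine le_trans (le_of_eq ?_) le_self_add
    abel
  have hup : totalLoss P X₀ X₁ D lam w =
      primaryMin P X₀ X₁ + ∑ k ∈ Finset.Ico 1 D, secondaryMin P X₀ X₁ k := by
    unfold totalLoss
    rw [primaryLoss_eq hX₀ hX₁ hL2 hw,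
      Finset.sum_congr rfl fun k _ => secondaryLoss_eq hX₀ hX₁ hL2 k hw]
    simp [h1, h2, h3]
  have h0 : primaryExcess P X₀ X₁ v + ∑ k ∈ Finset.Ico 1 D, secondaryExcess P X₀ X₁ k v ≤ 0 := by
    refine (ENNReal.add_le_add_iff_right hM).1 ?_
    rw [zero_add]
    exact hlow.trans (h.trans hup.le)
  have h0' := le_antisymm h0 zero_le
  rw [add_eq_zero] at h0'
  exact ⟨h0'.1, Finset.sum_eq_zero_iff.1 h0'.2⟩

end Losses

/-! ### The continuity equation of the marginal path. -/

section ContinuityEquation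

variable {d : ℕ} {Ω : Type*} [MeasurableSpace Ω] {P : Measure Ω} [IsProbabilityMeasure P]
  {X₀ X₁ : Ω → Vec d} {u : Vec d → ℝ → Vec d}

theorem measurable_velocity_along (hX₀ : Measurable X₀) (hX₁ : Measurable X₁)
    (hu : Measurable (Function.uncurry u)) :
    Measurable fun p : ℝ × Ω => u (interpolant X₀ X₁ p.1 p.2) p.1 :=
  hu.comp ((measurable_interpolant_uncurry hX₀ hX₁).prodMk measurable_fst)

theorem ae_velocity_along_eq (hX₀ : Measurable X₀) (hX₁ : Measurable X₁)
    (hae : ∀ᵐ t ∂(volume.restrict (Icc (0 : ℝ) 1)), ∀ᵐ x ∂(marginalPath P X₀ X₁ t),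
      u x t = conditionalVelocity P X₀ X₁ t x) :
    ∀ᵐ t ∂(volume.restrict (Icc (0 : ℝ) 1)), ∀ᵐ ω ∂P,
      u (interpolant X₀ X₁ t ω) t =
        condMean P (interpolant X₀ X₁ t) (targetVelocity X₀ X₁) (interpolant X₀ X₁ t ω) := by
  filter_upwards [hae] with t ht
  exact ae_of_ae_map (measurable_interpolant hX₀ hX₁ t).aemeasurable ht

/-- The velocity along the interpolant is square integrable in time and space. -/
theorem memLp_velocity_along (hX₀ : Measurable X₀) (hX₁ : Measurable X₁)
    (hL2 : MemLp (targetVelocity X₀ X₁) 2 P) (hu : Measurable (Function.uncurry u))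
    (hae : ∀ᵐ t ∂(volume.restrict (Icc (0 : ℝ) 1)), ∀ᵐ x ∂(marginalPath P X₀ X₁ t),
      u x t = conditionalVelocity P X₀ X₁ t x) :
    MemLp (fun p : ℝ × Ω => u (interpolant X₀ X₁ p.1 p.2) p.1) 2
      ((volume.restrict (Icc (0 : ℝ) 1)).prod P) := by
  have hm := measurable_velocity_along hX₀ hX₁ hu
  have hV := measurable_targetVelocity hX₀ hX₁
  rw [memLp_two_iff_integrable_sq_norm hm.aestronglyMeasurable,
    integrable_prod_iff (hm.norm.pow_const 2).aestronglyMeasurable]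
  have hcm := ae_velocity_along_eq hX₀ hX₁ hae
  constructor
  · filter_upwards [hcm] with t ht
    have h1 := memLp_condMean (measurable_interpolant hX₀ hX₁ t) hL2
    have h2 := (memLp_congr_ae ht).2 h1
    exact (memLp_two_iff_integrable_sq_norm h2.1).1 h2
  · refine Integrable.of_bound (C := ∫ ω, ‖targetVelocity X₀ X₁ ω‖ ^ 2 ∂P) ?_ ?_
    · exact (hm.norm.pow_const 2).norm.aestronglyMeasurable.integral_prod_right'
    · filter_upwards [hcm] with t ht
      have h1 := integral_sq_norm_condMean_le (measurable_interpolant hX₀ hX₁ t) hV hL2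
      rw [Real.norm_of_nonneg (integral_nonneg fun _ => norm_nonneg _)]
      refine le_trans (le_of_eq (integral_congr_ae ?_)) h1
      filter_upwards [ht] with ω hω
      simp [hω]

/-- The bound at almost every single time, rather than in the mean, makes the energy over a time
step proportional to its length. -/
theorem integral_sq_norm_velocity_along_le (hX₀ : Measurable X₀) (hX₁ : Measurable X₁)
    (hL2 : MemLp (targetVelocity X₀ X₁) 2 P)
    (hae : ∀ᵐ t ∂(volume.restrict (Icc (0 : ℝ) 1)), ∀ᵐ x ∂(marginalPath P X₀ X₁ t),
      u x t = conditionalVelocity P X₀ X₁ t x) :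
    ∀ᵐ t ∂(volume.restrict (Icc (0 : ℝ) 1)),
      Integrable (fun ω => ‖u (interpolant X₀ X₁ t ω) t‖ ^ 2) P ∧
      ∫ ω, ‖u (interpolant X₀ X₁ t ω) t‖ ^ 2 ∂P ≤ ∫ ω, ‖targetVelocity X₀ X₁ ω‖ ^ 2 ∂P := by
  have hV := measurable_targetVelocity hX₀ hX₁
  filter_upwards [ae_velocity_along_eq hX₀ hX₁ hae] with t ht
  have h1 := memLp_condMean (measurable_interpolant hX₀ hX₁ t) hL2
  have h2 := (memLp_congr_ae ht).2 h1
  refine ⟨(memLp_two_iff_integrable_sq_norm h2.1).1 h2,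
    le_trans (le_of_eq (integral_congr_ae ?_))
      (integral_sq_norm_condMean_le (measurable_interpolant hX₀ hX₁ t) hV hL2)⟩
  filter_upwards [ht] with ω hω
  simp [hω]

/-- Tested against functions of the position, the velocity agrees with the target velocity. -/
theorem integral_clm_velocity_along (hX₀ : Measurable X₀) (hX₁ : Measurable X₁)
    (hL2 : MemLp (targetVelocity X₀ X₁) 2 P)
    (hae : ∀ᵐ t ∂(volume.restrict (Icc (0 : ℝ) 1)), ∀ᵐ x ∂(marginalPath P X₀ X₁ t),
      u x t = conditionalVelocity P X₀ X₁ t x)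
    {ℓ : Vec d → Vec d →L[ℝ] ℝ} (hℓ : Measurable ℓ) {C : ℝ} (hC : ∀ x, ‖ℓ x‖ ≤ C) :
    ∀ᵐ t ∂(volume.restrict (Icc (0 : ℝ) 1)),
      ∫ ω, ℓ (interpolant X₀ X₁ t ω) (targetVelocity X₀ X₁ ω) ∂P =
        ∫ ω, ℓ (interpolant X₀ X₁ t ω) (u (interpolant X₀ X₁ t ω) t) ∂P := by
  have hV := measurable_targetVelocity hX₀ hX₁
  filter_upwards [ae_velocity_along_eq hX₀ hX₁ hae] with t ht
  have hX := measurable_interpolant hX₀ hX₁ t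
  rw [integral_clm_condMean hX hV (hL2.integrable one_le_two) hℓ]
  · refine integral_congr_ae ?_
    filter_upwards [ht] with ω hω
    rw [hω]
  · refine Integrable.mono' ((hL2.integrable one_le_two).norm.const_mul C)
      (measurable_clm_apply (hℓ.comp hX) hV).aestronglyMeasurable (ae_of_all _ fun ω => ?_)
    exact ((ℓ _).le_opNorm _).trans (by gcongr; exact hC _)

omit [MeasurableSpace Ω] in
theorem hasDerivAt_interpolant (t : ℝ) (ω : Ω) :
    HasDerivAt (fun s => interpolant X₀ X₁ s ω) (targetVelocity X₀ X₁ ω) t := by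
  simp_rw [interpolant_eq]
  simpa using ((hasDerivAt_id t).smul_const (targetVelocity X₀ X₁ ω)).const_add (X₀ ω)

omit [MeasurableSpace Ω] in
theorem continuous_interpolant_time (ω : Ω) : Continuous fun s => interpolant X₀ X₁ s ω :=
  continuous_iff_continuousAt.2 fun t => (hasDerivAt_interpolant t ω).continuousAt

/-- The marginal path solves the continuity equation of every velocity that is a version of the
conditional velocity. -/
theorem solvesContinuityEquation (hX₀ : Measurable X₀) (hX₁ : Measurable X₁)
    (hL2 : MemLp (targetVelocity X₀ X₁) 2 P) (hu : Measurable (Function.uncurry u))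
    (hae : ∀ᵐ t ∂(volume.restrict (Icc (0 : ℝ) 1)), ∀ᵐ x ∂(marginalPath P X₀ X₁ t),
      u x t = conditionalVelocity P X₀ X₁ t x) :
    SolvesContinuityEquation u (marginalPath P X₀ X₁) := by
  have hm := measurable_velocity_along hX₀ hX₁ hu
  have hV := measurable_targetVelocity hX₀ hX₁
  have hus : ∀ s, Measurable fun x => u x s := fun s =>
    hu.comp (measurable_id.prodMk measurable_const)
  have hmap : ∀ (s : ℝ) {f : Vec d → ℝ}, Measurable f →
      ∫ x, f x ∂(marginalPath P X₀ X₁ s) = ∫ ω, f (interpolant X₀ X₁ s ω) ∂P :=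
    fun s f hf => integral_map (measurable_interpolant hX₀ hX₁ s).aemeasurable
      hf.aestronglyMeasurable
  have hint : Integrable (fun p : ℝ × Ω => u (interpolant X₀ X₁ p.1 p.2) p.1)
      ((volume.restrict (Icc (0 : ℝ) 1)).prod P) :=
    (memLp_velocity_along hX₀ hX₁ hL2 hu hae).integrable one_le_two
  refine ⟨?_, ?_, fun φ hφ hφc => ?_⟩
  · filter_upwards [hint.prod_right_ae] with s hs
    exact (integrable_map_measure (hus s).aestronglyMeasurable
      (measurable_interpolant hX₀ hX₁ s).aemeasurable).2 hs
  · have h1 := hint.norm.integral_prod_left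
    refine h1.congr (ae_of_all _ fun s => ?_)
    exact (hmap s (hus s).norm).symm
  · have hD : Continuous (fderiv ℝ φ) := hφ.continuous_fderiv (by simp)
    have hdiff : Differentiable ℝ φ := hφ.differentiable (by simp)
    obtain ⟨C, hC⟩ := (hφc.fderiv (𝕜 := ℝ)).exists_bound_of_continuous hD
    have hDu : ∀ s, Measurable fun x => fderiv ℝ φ x (u x s) := fun s =>
      measurable_clm_apply hD.measurable (hus s)
    have hbd : ∀ x y, ‖fderiv ℝ φ x y‖ ≤ C * ‖y‖ := fun x y =>
      ((fderiv ℝ φ x).le_opNorm y).trans (by gcongr; exact hC x)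
    have hI := measurable_interpolant_uncurry (X₀ := X₀) (X₁ := X₁) hX₀ hX₁
    have hint2 : Integrable (fun p : ℝ × Ω => fderiv ℝ φ (interpolant X₀ X₁ p.1 p.2)
        (u (interpolant X₀ X₁ p.1 p.2) p.1)) ((volume.restrict (Icc (0 : ℝ) 1)).prod P) :=
      Integrable.mono' (hint.norm.const_mul C)
        (measurable_clm_apply (hD.measurable.comp hI) hm).aestronglyMeasurable
        (ae_of_all _ fun p => hbd _ _)
    constructor
    · refine hint2.integral_prod_left.congr (ae_of_all _ fun s => ?_)
      exact (hmap s (hDu s)).symm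
    · intro t ht
      have hVint : Integrable (fun p : ℝ × Ω => fderiv ℝ φ (interpolant X₀ X₁ p.1 p.2)
          (targetVelocity X₀ X₁ p.2)) ((volume.restrict (Ioc (0 : ℝ) t)).prod P) := by
        refine Integrable.mono' (g := fun p : ℝ × Ω => C * ‖targetVelocity X₀ X₁ p.2‖)
          (((hL2.integrable one_le_two).comp_snd (volume.restrict (Ioc (0 : ℝ) t))).norm.const_mul C)
          (measurable_clm_apply (hD.measurable.comp hI)
            (hV.comp measurable_snd)).aestronglyMeasurable
          (ae_of_all _ fun p => hbd _ _)
      -- For each ω the interpolant is a segment with constant velocity.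
      have hftc : ∀ ω, φ (interpolant X₀ X₁ t ω) - φ (interpolant X₀ X₁ 0 ω) =
          ∫ s in (0 : ℝ)..t, fderiv ℝ φ (interpolant X₀ X₁ s ω) (targetVelocity X₀ X₁ ω) := by
        intro ω
        symm
        refine intervalIntegral.integral_eq_sub_of_hasDerivAt
          (f := fun s => φ (interpolant X₀ X₁ s ω)) (fun s _ => ?_) ?_
        · exact (hdiff _).hasFDerivAt.comp_hasDerivAt s (hasDerivAt_interpolant s ω)
        · exact ((hD.comp (continuous_interpolant_time ω)).clm_apply
            continuous_const).intervalIntegrable _ _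
      obtain ⟨B, hB⟩ := hφc.exists_bound_of_continuous hφ.continuous
      have hφi : ∀ s, Integrable (fun ω => φ (interpolant X₀ X₁ s ω)) P := fun s =>
        Integrable.of_bound (hφ.continuous.measurable.comp
          (measurable_interpolant hX₀ hX₁ s)).aestronglyMeasurable B (ae_of_all _ fun ω => hB _)
      rw [hmap t hφ.continuous.measurable, hmap 0 hφ.continuous.measurable,
        ← integral_sub (hφi t) (hφi 0)]
      simp_rw [hftc, intervalIntegral.integral_of_le ht.1]
      rw [integral_integral_swap (f := fun ω s => fderiv ℝ φ (interpolant X₀ X₁ s ω)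
        (targetVelocity X₀ X₁ ω)) hVint.swap]
      refine integral_congr_ae ?_
      -- After Fubini, the target velocity is replaced by the field at almost every time.
      have h1 := integral_clm_velocity_along hX₀ hX₁ hL2 hae hD.measurable hC
      have h2 := ae_restrict_of_ae_restrict_of_subset
        (fun s hs => ⟨hs.1.le, hs.2.trans ht.2⟩ : Ioc 0 t ⊆ Icc (0 : ℝ) 1) h1
      filter_upwards [h2] with s hs
      rw [hs, hmap s (hDu s)]

end ContinuityEquation

/-! ### Carathéodory theory for Lipschitz fields: Grönwall, existence, flow. -/

section ODE

variable {d : ℕ} {K : ℝ≥0} {b : Vec d → ℝ → Vec d}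

/-- The integral form of Grönwall's inequality. -/
theorem le_mul_exp_of_le_add_integral {φ : ℝ → ℝ} {A k s T : ℝ} (hk : 0 ≤ k)
    (hφ : ContinuousOn φ (Icc s T))
    (h : ∀ t ∈ Icc s T, φ t ≤ A + k * ∫ r in s..t, φ r) :
    ∀ t ∈ Icc s T, φ t ≤ A * Real.exp (k * (t - s)) := by
  intro t ht
  have hsT : s ≤ T := ht.1.trans ht.2
  -- A continuous extension to ℝ makes the primitive differentiable at the endpoints too; the
  -- differential Grönwall inequality is then applied to the right-hand side `G`.
  let φ' : ℝ → ℝ := IccExtend hsT ((Icc s T).domRestrict φ)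
  have hφ' : Continuous φ' := (continuousOn_iff_continuous_domRestrict.1 hφ).Icc_extend'
  have heq : ∀ r ∈ Icc s T, φ' r = φ r := fun r hr => IccExtend_of_mem hsT _ hr
  have hint : ∀ r ∈ Icc s T, ∫ q in s..r, φ q = ∫ q in s..r, φ' q := fun r hr => by
    refine intervalIntegral.integral_congr fun q hq => (heq q ?_).symm
    rw [uIcc_of_le hr.1] at hq
    exact ⟨hq.1, hq.2.trans hr.2⟩
  let G : ℝ → ℝ := fun r => A + k * ∫ q in s..r, φ' q
  have hG : ∀ r, HasDerivAt G (k * φ' r) r := fun r =>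
    ((intervalIntegral.integral_hasDerivAt_right (hφ'.intervalIntegrable _ _)
      hφ'.stronglyMeasurable.stronglyMeasurableAtFilter hφ'.continuousAt).const_mul k).const_add A
  have hle : ∀ r ∈ Icc s T, φ' r ≤ G r := fun r hr => by
    rw [heq r hr]
    refine (h r hr).trans (le_of_eq ?_)
    simp only [G, hint r hr]
  have hgr := le_gronwallBound_of_liminf_deriv_right_le (f := G) (f' := fun r => k * φ' r)
    (δ := A) (K := k) (ε := 0) (a := s) (b := T)
    (fun r _ => (hG r).continuousAt.continuousWithinAt)
    (fun r _ q hq => (hG r).hasDerivWithinAt.liminf_right_slope_le hq)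
    (by simp [G])
    (fun r hr => by
      rw [add_zero]
      exact mul_le_mul_of_nonneg_left (hle r ⟨hr.1, hr.2.le⟩) hk) t ht
  rw [gronwallBound_ε0] at hgr
  exact (heq t ht ▸ hle t ht).trans hgr

/-- A time-dependent vector field that is measurable, uniformly Lipschitz in space and integrable
in time. -/
structure IsLipschitzField (K : ℝ≥0) (b : Vec d → ℝ → Vec d) : Prop where
  measurable : Measurable (Function.uncurry b)
  lipschitz : ∀ t, LipschitzWith K fun x => b x t
  integrable : Integrable (b 0)

namespace IsLipschitzField

theorem norm_sub_le (hb : IsLipschitzField K b) (x y : Vec d) (t : ℝ) :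
    ‖b x t - b y t‖ ≤ K * ‖x - y‖ := (hb.lipschitz t).norm_sub_le x y

/-- Growth is at most linear: |b(y, r)| ≤ |b(0, r)| + K |y|, where `b 0` is the time course of the
field at the origin. -/
theorem intervalIntegrable (hb : IsLipschitzField K b) {y : ℝ → Vec d} {s t : ℝ}
    (hy : ContinuousOn y (uIcc s t)) : IntervalIntegrable (fun r => b (y r) r) volume s t := by
  rw [intervalIntegrable_iff']
  have hym : AEStronglyMeasurable y (volume.restrict (uIcc s t)) :=
    hy.aestronglyMeasurable measurableSet_uIcc
  have hyi : IntegrableOn (fun r => ‖y r‖) (uIcc s t) := hy.norm.integrableOn_uIcc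
  refine Integrable.mono' ((hb.integrable.norm.integrableOn (s := uIcc s t)).add
    (hyi.const_mul (K : ℝ))) ?_ (ae_of_all _ fun r => ?_)
  · exact (hb.measurable.comp_aemeasurable
      (hym.aemeasurable.prodMk aemeasurable_id)).aestronglyMeasurable
  · have h1 := hb.norm_sub_le (y r) 0 r
    rw [sub_zero] at h1
    calc ‖b (y r) r‖ = ‖b 0 r + (b (y r) r - b 0 r)‖ := by rw [add_sub_cancel]
      _ ≤ ‖b 0 r‖ + ‖b (y r) r - b 0 r‖ := norm_add_le _ _
      _ ≤ _ := by simp only [Pi.add_apply]; gcongr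

theorem continuous_primitive (hb : IsLipschitzField K b) {y : ℝ → Vec d} (hy : Continuous y)
    (s : ℝ) : Continuous fun t => ∫ r in s..t, b (y r) r :=
  intervalIntegral.continuous_primitive (fun _ _ => hb.intervalIntegrable hy.continuousOn) s

/-- Stability of solutions under perturbations of the initial value and of the velocity. -/
theorem norm_sub_le_of_integral_eq (hb : IsLipschitzField K b) {y z a : ℝ → Vec d}
    {x x' : Vec d} {s T : ℝ} (hy : ContinuousOn y (Icc s T)) (hz : ContinuousOn z (Icc s T))
    (ha : IntervalIntegrable a volume s T)
    (hys : ∀ t ∈ Icc s T, y t = x + ∫ r in s..t, b (y r) r)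
    (hzs : ∀ t ∈ Icc s T, z t = x' + ∫ r in s..t, a r) :
    ∀ t ∈ Icc s T, ‖y t - z t‖ ≤
      (‖x - x'‖ + ∫ r in s..T, ‖a r - b (z r) r‖) * Real.exp (K * (t - s)) := by
  intro t ht
  have hsT := ht.1.trans ht.2
  refine le_mul_exp_of_le_add_integral K.coe_nonneg (hy.sub hz).norm (fun r hr => ?_) t ht
  have hsub : uIcc s r ⊆ Icc s T := by
    rw [uIcc_of_le hr.1]; exact Icc_subset_Icc_right hr.2
  have hby := hb.intervalIntegrable (hy.mono hsub)
  have hbz := hb.intervalIntegrable (hz.mono hsub)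
  have har : IntervalIntegrable a volume s r :=
    ha.mono_set (by rw [uIcc_of_le hsT]; exact hsub)
  have hbzT := hb.intervalIntegrable (y := z) (s := s) (t := T) (by rwa [uIcc_of_le hsT])
  have hyz : IntervalIntegrable (fun q => ‖y q - z q‖) volume s r :=
    ((hy.sub hz).norm.mono hsub).intervalIntegrable
  -- The defect is enlarged to the whole interval so that it becomes a constant in Grönwall's
  -- inequality.
  have hmono : ∫ q in s..r, ‖a q - b (z q) q‖ ≤ ∫ q in s..T, ‖a q - b (z q) q‖ := by
    refine intervalIntegral.integral_mono_interval le_rfl hr.1 hr.2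
      (ae_of_all _ fun q => norm_nonneg _) (ha.sub hbzT).norm
  have key : ‖∫ q in s..r, (b (y q) q - a q)‖ ≤
      ∫ q in s..r, (‖a q - b (z q) q‖ + K * ‖y q - z q‖) := by
    refine (intervalIntegral.norm_integral_le_integral_norm hr.1).trans ?_
    refine intervalIntegral.integral_mono_on hr.1 (hby.sub har).norm
      ((har.sub hbz).norm.add (hyz.const_mul _)) fun q _ => ?_
    calc ‖b (y q) q - a q‖ = ‖(b (z q) q - a q) + (b (y q) q - b (z q) q)‖ := by
          congr 1; abel
      _ ≤ ‖b (z q) q - a q‖ + ‖b (y q) q - b (z q) q‖ := norm_add_le _ _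
      _ ≤ _ := by
          rw [norm_sub_rev (b (z q) q)]
          gcongr
          exact hb.norm_sub_le _ _ _
  rw [intervalIntegral.integral_add (har.sub hbz).norm (hyz.const_mul _),
    intervalIntegral.integral_const_mul] at key
  calc ‖y r - z r‖ = ‖(x - x') + ∫ q in s..r, (b (y q) q - a q)‖ := by
        rw [intervalIntegral.integral_sub hby har, hys r hr, hzs r hr]
        congr 1; abel
    _ ≤ ‖x - x'‖ + ‖∫ q in s..r, (b (y q) q - a q)‖ := norm_add_le _ _
    _ ≤ _ := by
        simp only [Pi.sub_apply]
        linarith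

/-- Existence of solutions, by contraction in an exponentially weighted norm. -/
theorem exists_solution (hb : IsLipschitzField K b) {s T : ℝ} (hsT : s ≤ T) (x : Vec d) :
    ∃ y : ℝ → Vec d, Continuous y ∧ ∀ t ∈ Icc s T, y t = x + ∫ r in s..t, b (y r) r := by
  -- The unknown is `z = y / w`. Since ∫ K w = (w - 1)/2, the exponent `2K` makes the Picard map a
  -- contraction with factor 1/2 on an interval of any length.
  let w : ℝ → ℝ := fun r => Real.exp (2 * K * (r - s))
  have hw : Continuous w := by fun_prop
  have hwpos : ∀ r, 0 < w r := fun r => Real.exp_pos _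
  -- Clamping time to [s, T] keeps the iterates bounded and continuous on all of ℝ.
  let c : ℝ → ℝ := fun t => max s (min T t)
  have hc : Continuous c := by fun_prop
  have hcmem : ∀ t, c t ∈ Icc s T := fun t => ⟨le_max_left _ _, max_le hsT (min_le_left _ _)⟩
  have hcid : ∀ t ∈ Icc s T, c t = t := fun t ht => by
    simp only [c]; rw [min_eq_right ht.2, max_eq_right ht.1]
  let Φ₀ : BoundedContinuousFunction ℝ (Vec d) → ℝ → Vec d := fun z t =>
    (w t)⁻¹ • (x + ∫ r in s..t, b (w r • z r) r)
  have hΦ₀ : ∀ z, Continuous (Φ₀ z) := fun z => by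
    have h1 : Continuous fun r => w r • z r := hw.smul z.continuous
    exact (hw.inv₀ fun r => (hwpos r).ne').smul (continuous_const.add (hb.continuous_primitive h1 s))
  have hbd : ∀ z, ∃ C, ∀ t, ‖Φ₀ z (c t)‖ ≤ C := fun z => by
    obtain ⟨C, hC⟩ := isCompact_Icc.exists_bound_of_continuousOn (hΦ₀ z).continuousOn
      (s := Icc s T)
    exact ⟨C, fun t => hC _ (hcmem t)⟩
  choose C hC using hbd
  let Φ : BoundedContinuousFunction ℝ (Vec d) → BoundedContinuousFunction ℝ (Vec d) := fun z =>
    BoundedContinuousFunction.ofNormedAddCommGroup (fun t => Φ₀ z (c t)) ((hΦ₀ z).comp hc)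
      (C z) (hC z)
  have hcontr : ContractingWith (1 / 2 : ℝ≥0) Φ := by
    refine ⟨by rw [← NNReal.coe_lt_coe]; norm_num, LipschitzWith.of_dist_le_mul fun z z' => ?_⟩
    refine (BoundedContinuousFunction.dist_le (by positivity)).2 fun t => ?_
    have ht := hcmem t
    change dist (Φ₀ z (c t)) (Φ₀ z' (c t)) ≤ _
    have h1 : Continuous fun r => w r • z r := hw.smul z.continuous
    have h2 : Continuous fun r => w r • z' r := hw.smul z'.continuous
    have hd : ∀ r, ‖b (w r • z r) r - b (w r • z' r) r‖ ≤ (K * w r) * dist z z' := fun r => by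
      refine (hb.norm_sub_le _ _ r).trans ?_
      rw [← smul_sub, norm_smul, Real.norm_of_nonneg (hwpos r).le, mul_assoc]
      gcongr
      rw [← dist_eq_norm]
      exact BoundedContinuousFunction.dist_coe_le_dist r
    have hint : ∫ r in s..c t, (K * w r) * dist z z' = (w (c t) - 1) / 2 * dist z z' := by
      rw [intervalIntegral.integral_mul_const]
      congr 1
      have hder : ∀ r ∈ uIcc s (c t), HasDerivAt (fun r => w r / 2) (K * w r) r := fun r _ => by
        have h3 : HasDerivAt w (w r * (2 * K * 1)) r :=
          (((hasDerivAt_id r).sub_const s).const_mul (2 * (K : ℝ))).exp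
        convert! h3.div_const 2 using 1
        ring
      rw [intervalIntegral.integral_eq_sub_of_hasDerivAt hder
        ((hw.const_mul _).intervalIntegrable _ _)]
      simp only [w, sub_self, mul_zero, Real.exp_zero]
      ring
    have hle : ‖∫ r in s..c t, (b (w r • z r) r - b (w r • z' r) r)‖ ≤
        (w (c t) - 1) / 2 * dist z z' := by
      rw [← hint]
      refine intervalIntegral.norm_integral_le_of_norm_le ht.1 (ae_of_all _ fun r _ => hd r) ?_
      exact ((hw.const_mul _).mul_const _).intervalIntegrable _ _
    have heq : Φ₀ z (c t) - Φ₀ z' (c t) =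
        (w (c t))⁻¹ • ∫ r in s..c t, (b (w r • z r) r - b (w r • z' r) r) := by
      rw [intervalIntegral.integral_sub (hb.intervalIntegrable h1.continuousOn)
        (hb.intervalIntegrable h2.continuousOn)]
      simp only [Φ₀]
      rw [← smul_sub, add_sub_add_left_eq_sub]
    rw [dist_eq_norm, heq, norm_smul, norm_inv, Real.norm_of_nonneg (hwpos _).le,
      inv_mul_le_iff₀ (hwpos _)]
    refine hle.trans ?_
    have := dist_nonneg (x := z) (y := z')
    push_cast
    nlinarith
  obtain ⟨z, hz, -⟩ := hcontr.exists_fixedPoint 0 (edist_ne_top _ _)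
  refine ⟨fun r => w r • z r, hw.smul z.continuous, fun t ht => ?_⟩
  have h1 : z t = Φ₀ z t := by
    conv_lhs => rw [← hz.eq]
    change Φ₀ z (c t) = _
    rw [hcid t ht]
  simp only
  rw [h1, smul_inv_smul₀ (hwpos t).ne']

end IsLipschitzField

/-- The two-parameter flow of `b` up to time `1`. -/
structure IsFlow (b : Vec d → ℝ → Vec d) (ψ : ℝ → ℝ → Vec d → Vec d) : Prop where
  continuous : ∀ s x, Continuous fun t => ψ s t x
  eq : ∀ s x, ∀ t ∈ Icc s 1, ψ s t x = x + ∫ r in s..t, b (ψ s r x) r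

theorem IsLipschitzField.exists_isFlow (hb : IsLipschitzField K b) : ∃ ψ, IsFlow b ψ := by
  have h : ∀ (s : ℝ) (x : Vec d), ∃ y : ℝ → Vec d, Continuous y ∧
      ∀ t ∈ Icc s 1, y t = x + ∫ r in s..t, b (y r) r := fun s x => by
    -- The maximum covers s > 1, where the equation on [s, 1] is vacuous.
    obtain ⟨y, h1, h2⟩ := hb.exists_solution (le_max_left s 1) x
    exact ⟨y, h1, fun t ht => h2 t ⟨ht.1, ht.2.trans (le_max_right _ _)⟩⟩
  choose y hy hys using h
  exact ⟨fun s t x => y s x t, hy, hys⟩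

namespace IsFlow

variable {ψ : ℝ → ℝ → Vec d → Vec d}

theorem self (hψ : IsFlow b ψ) {s : ℝ} (hs : s ≤ 1) (x : Vec d) : ψ s s x = x := by
  rw [hψ.eq s x s ⟨le_rfl, hs⟩, intervalIntegral.integral_same, add_zero]

/-- Comparison of the flow with a path of prescribed velocity. -/
theorem norm_sub_le (hψ : IsFlow b ψ) (hb : IsLipschitzField K b) {z a : ℝ → Vec d}
    {x x' : Vec d} {s T : ℝ} (hT : T ≤ 1) (hz : ContinuousOn z (Icc s T))
    (ha : IntervalIntegrable a volume s T)
    (hzs : ∀ t ∈ Icc s T, z t = x' + ∫ r in s..t, a r) :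
    ∀ t ∈ Icc s T, ‖ψ s t x - z t‖ ≤
      (‖x - x'‖ + ∫ r in s..T, ‖a r - b (z r) r‖) * Real.exp (K * (t - s)) :=
  hb.norm_sub_le_of_integral_eq (hψ.continuous s x).continuousOn hz ha
    (fun t ht => hψ.eq s x t ⟨ht.1, ht.2.trans hT⟩) hzs

/-- Uniqueness: stability with equal initial values and no defect. -/
theorem eq_of_integral_eq (hψ : IsFlow b ψ) (hb : IsLipschitzField K b) {z : ℝ → Vec d}
    {x : Vec d} {s T : ℝ} (hT : T ≤ 1) (hz : ContinuousOn z (Icc s T))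
    (hzs : ∀ t ∈ Icc s T, z t = x + ∫ r in s..t, b (z r) r) :
    ∀ t ∈ Icc s T, z t = ψ s t x := by
  intro t ht
  have hsT := ht.1.trans ht.2
  have h := hψ.norm_sub_le hb (x := x) hT hz
    (hb.intervalIntegrable (by rwa [uIcc_of_le hsT])) hzs t ht
  simp only [sub_self, norm_zero, intervalIntegral.integral_zero, add_zero, zero_mul] at h
  exact (sub_eq_zero.1 (norm_le_zero_iff.1 h)).symm

theorem norm_sub_le_mul_exp (hψ : IsFlow b ψ) (hb : IsLipschitzField K b) {s t : ℝ}
    (hst : s ≤ t) (ht : t ≤ 1) (x y : Vec d) :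
    ‖ψ s t x - ψ s t y‖ ≤ ‖x - y‖ * Real.exp (K * (t - s)) := by
  have h := hψ.norm_sub_le hb (x := x) ht (hψ.continuous s y).continuousOn
    (hb.intervalIntegrable (hψ.continuous s y).continuousOn)
    (fun r hr => hψ.eq s y r ⟨hr.1, hr.2.trans ht⟩) t ⟨hst, le_rfl⟩
  simpa using h

/-- The trajectory from time s, seen from time t on, solves the equation restarted at t; uniqueness
identifies the two. -/
theorem comp (hψ : IsFlow b ψ) (hb : IsLipschitzField K b) {s t T : ℝ} (hst : s ≤ t)
    (htT : t ≤ T) (hT : T ≤ 1) (x : Vec d) : ψ t T (ψ s t x) = ψ s T x := by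
  refine (hψ.eq_of_integral_eq hb (z := fun r => ψ s r x) hT
    (hψ.continuous s x).continuousOn (fun r hr => ?_) T ⟨htT, le_rfl⟩).symm
  have hi : ∀ p q, IntervalIntegrable (fun r => b (ψ s r x) r) volume p q := fun p q =>
    hb.intervalIntegrable (hψ.continuous s x).continuousOn
  rw [hψ.eq s x r ⟨hst.trans hr.1, hr.2.trans hT⟩, hψ.eq s x t ⟨hst, htT.trans hT⟩, add_assoc,
    intervalIntegral.integral_add_adjacent_intervals (hi _ _) (hi _ _)]

/-- The flow over a short time almost commutes with translations. -/
theorem norm_translate_sub_le (hψ : IsFlow b ψ) (hb : IsLipschitzField K b) {s t : ℝ}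
    (hst : s ≤ t) (ht : t ≤ 1) (x y : Vec d) :
    ‖ψ s t (x - y) - (ψ s t x - y)‖ ≤ K * Real.exp (K * (t - s)) * ‖y‖ * (t - s) := by
  have hi : ∀ x, IntervalIntegrable (fun r => b (ψ s r x) r) volume s t := fun x =>
    hb.intervalIntegrable (hψ.continuous s x).continuousOn
  -- The displacement y cancels and only the velocity difference along two nearby trajectories
  -- remains. This yields the factor t - s, without which the errors could not be summed over steps.
  have heq : ψ s t (x - y) - (ψ s t x - y) =
      ∫ r in s..t, (b (ψ s r (x - y)) r - b (ψ s r x) r) := by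
    rw [intervalIntegral.integral_sub (hi _) (hi _), hψ.eq s _ t ⟨hst, ht⟩,
      hψ.eq s x t ⟨hst, ht⟩]
    abel
  rw [heq, ← abs_of_nonneg (sub_nonneg.2 hst)]
  refine intervalIntegral.norm_integral_le_of_norm_le_const fun r hr => ?_
  rw [uIoc_of_le hst] at hr
  rw [abs_of_nonneg (sub_nonneg.2 hst)]
  refine (hb.norm_sub_le _ _ _).trans ?_
  rw [mul_assoc]
  gcongr
  refine (hψ.norm_sub_le_mul_exp hb hr.1.le (hr.2.trans ht) _ _).trans ?_
  rw [sub_sub_cancel_left, norm_neg, mul_comm]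
  gcongr
  exact hr.2

end IsFlow

end ODE

/-! ### Mollification of Lipschitz functions. -/

section Mollifier

variable {d : ℕ}

/-- The average of `H` around `x`, weighted by the bump function `ρ`. -/
noncomputable def mollify (ρ : ContDiffBump (0 : Vec d)) (H : Vec d → ℝ) (x : Vec d) : ℝ :=
  ∫ y, ρ.normed volume y * H (x - y)

theorem integrable_mollify_integrand (ρ : ContDiffBump (0 : Vec d)) {H : Vec d → ℝ}
    (hH : Continuous H) (x : Vec d) :
    Integrable fun y => ρ.normed volume y * H (x - y) :=
  (ρ.continuous_normed.mul (hH.comp (continuous_const.sub continuous_id))).integrable_of_hasCompactSupport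
    (ρ.hasCompactSupport_normed.mul_right)

/-- The normalized bump is a probability density supported in the ball of radius `rOut`. Two
functions and two base points are allowed, so that bounds, Lipschitz constants, approximation errors
and the comparison through the flow are all instances. -/
theorem abs_mollify_sub_le (ρ : ContDiffBump (0 : Vec d)) {H₁ H₂ : Vec d → ℝ}
    (h₁ : Continuous H₁) (h₂ : Continuous H₂) {x x' : Vec d} {c : ℝ}
    (h : ∀ y, ‖y‖ ≤ ρ.rOut → |H₁ (x - y) - H₂ (x' - y)| ≤ c) :
    |mollify ρ H₁ x - mollify ρ H₂ x'| ≤ c := by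
  unfold mollify
  rw [← integral_sub (integrable_mollify_integrand ρ h₁ x) (integrable_mollify_integrand ρ h₂ x'),
    ← Real.norm_eq_abs]
  have hc : c = ∫ y, ρ.normed volume y * c := by
    rw [integral_mul_const, ρ.integral_normed, one_mul]
  rw [hc]
  refine norm_integral_le_of_norm_le (ρ.integrable_normed.mul_const c) (ae_of_all _ fun y => ?_)
  rw [← mul_sub, norm_mul, Real.norm_of_nonneg (ρ.nonneg_normed y)]
  by_cases hy : ‖y‖ ≤ ρ.rOut
  · exact mul_le_mul_of_nonneg_left (h y hy) (ρ.nonneg_normed y)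
  · have : ρ.normed volume y = 0 := by
      by_contra h0
      have h1 : y ∈ Function.support (ρ.normed volume) := h0
      rw [ρ.support_normed_eq, mem_ball_zero_iff] at h1
      exact hy h1.le
    simp [this]

theorem abs_mollify_sub_self_le (ρ : ContDiffBump (0 : Vec d)) {L : ℝ≥0} {H : Vec d → ℝ}
    (hH : LipschitzWith L H) (x : Vec d) : |mollify ρ H x - H x| ≤ L * ρ.rOut := by
  have h1 : mollify ρ (fun _ => H x) x = H x := by
    unfold mollify
    rw [integral_mul_const, ρ.integral_normed, one_mul]
  rw [← h1]
  refine abs_mollify_sub_le ρ hH.continuous continuous_const fun y hy => ?_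
  rw [← Real.norm_eq_abs]
  refine (hH.norm_sub_le _ _).trans ?_
  rw [sub_sub_cancel_left, norm_neg]
  gcongr

theorem abs_mollify_le (ρ : ContDiffBump (0 : Vec d)) {B : ℝ} {H : Vec d → ℝ}
    (hH : Continuous H) (hB : ∀ x, |H x| ≤ B) (x : Vec d) : |mollify ρ H x| ≤ B := by
  have h1 : mollify ρ (fun _ => 0) x = 0 := by simp [mollify]
  have := abs_mollify_sub_le ρ hH (continuous_const (y := (0 : ℝ))) (x := x) (x' := x) (c := B)
    fun y _ => by simpa using hB _
  rwa [h1, sub_zero] at this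

theorem lipschitzWith_mollify (ρ : ContDiffBump (0 : Vec d)) {L : ℝ≥0} {H : Vec d → ℝ}
    (hH : LipschitzWith L H) : LipschitzWith L (mollify ρ H) := by
  refine LipschitzWith.of_dist_le_mul fun x x' => ?_
  rw [Real.dist_eq]
  refine abs_mollify_sub_le ρ hH.continuous hH.continuous fun y _ => ?_
  have := hH.dist_le_mul (x - y) (x' - y)
  rwa [Real.dist_eq, dist_sub_right] at this

theorem integrable_translate_smul {F : Type*} [NormedAddCommGroup F] [NormedSpace ℝ F]
    {H : Vec d → ℝ} (hH : Continuous H) {r : Vec d → F} (hr : Continuous r)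
    (hrc : HasCompactSupport r) (x : Vec d) : Integrable fun y => H (x - y) • r y := by
  have h1 : Continuous fun y => H (x - y) • r y :=
    (hH.comp (continuous_const.sub continuous_id)).smul hr
  refine h1.integrable_of_hasCompactSupport (hrc.mono fun y hy => ?_)
  rw [Function.mem_support] at hy ⊢
  contrapose! hy
  rw [hy, smul_zero]

/-- Mollified Lipschitz functions have a Lipschitz derivative, with a constant that depends only
on the mollifier and on the Lipschitz constant. -/
theorem exists_hasFDerivAt_mollify (ρ : ContDiffBump (0 : Vec d)) (L : ℝ≥0) :
    ∃ M : ℝ, 0 ≤ M ∧ ∀ H : Vec d → ℝ, LipschitzWith L H → ∃ DH : Vec d → Vec d →L[ℝ] ℝ,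
      (∀ x, HasFDerivAt (mollify ρ H) (DH x) x) ∧ (∀ x, ‖DH x‖ ≤ L) ∧
      ∀ x x', ‖DH x - DH x'‖ ≤ M * ‖x - x'‖ := by
  let Λ := (ContinuousLinearMap.lsmul ℝ ℝ : ℝ →L[ℝ] ℝ →L[ℝ] ℝ).precompL (Vec d)
  let ρ' := fderiv ℝ (ρ.normed (volume : Measure (Vec d)))
  have hρ1 : ContDiff ℝ 1 (ρ.normed (volume : Measure (Vec d))) := ρ.contDiff_normed
  have hρ' : Continuous ρ' := hρ1.continuous_fderiv one_ne_zero
  have hρc : HasCompactSupport ρ' := ρ.hasCompactSupport_normed.fderiv (𝕜 := ℝ)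
  have hρi : Integrable fun y => ‖ρ' y‖ := (hρ'.integrable_of_hasCompactSupport hρc).norm
  have hΛ : ∀ (a : Vec d →L[ℝ] ℝ) (h : ℝ), Λ a h = h • a := fun a h => by
    ext v
    simp [Λ, ContinuousLinearMap.precompL, mul_comm]
  refine ⟨(∫ y, ‖ρ' y‖) * L, by positivity, fun H hH => ?_⟩
  -- The derivative falls on the bump, so `DH` inherits the Lipschitz bound of `H` times the L¹ norm
  -- of ρ'.
  let DH : Vec d → Vec d →L[ℝ] ℝ := fun x => ∫ y, H (x - y) • ρ' y
  have hder : ∀ x, HasFDerivAt (mollify ρ H) (DH x) x := fun x => by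
    have h1 := ρ.hasCompactSupport_normed.hasFDerivAt_convolution_left
      (ContinuousLinearMap.lsmul ℝ ℝ) hρ1
      (hH.continuous.locallyIntegrable (μ := (volume : Measure (Vec d)))) x
    have h2 : DH x = ∫ y, Λ (ρ' y) (H (x - y)) := by simp_rw [hΛ]; rfl
    rw [h2]
    exact h1
  have hi := integrable_translate_smul hH.continuous hρ' hρc
  refine ⟨DH, hder, fun x => (hder x).le_of_lipschitz (lipschitzWith_mollify ρ hH), fun x x' => ?_⟩
  simp only [DH]
  rw [← integral_sub (hi x) (hi x')]
  have hM : (∫ y, ‖ρ' y‖) * L * ‖x - x'‖ = ∫ y, ‖ρ' y‖ * (L * ‖x - x'‖) := by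
    rw [integral_mul_const]; ring
  rw [hM]
  refine norm_integral_le_of_norm_le (hρi.mul_const _) (ae_of_all _ fun y => ?_)
  rw [← sub_smul, norm_smul, mul_comm]
  have := hH.norm_sub_le (x - y) (x' - y)
  rw [sub_sub_sub_cancel_right] at this
  gcongr

end Mollifier

/-! ### One time step: a straight segment against the flow. -/

section OneStep

variable {d : ℕ} {K : ℝ≥0} {b : Vec d → ℝ → Vec d} {ψ : ℝ → ℝ → Vec d → Vec d}

/-- Cauchy–Schwarz, from the nonnegative integral of ((t - s) g - m)², where m is the integral of g.
-/
theorem sq_intervalIntegral_le {g : ℝ → ℝ} {s t : ℝ} (hst : s ≤ t)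
    (hg : IntervalIntegrable g volume s t) (hg2 : IntervalIntegrable (fun r => g r ^ 2) volume s t) :
    (∫ r in s..t, g r) ^ 2 ≤ (t - s) * ∫ r in s..t, g r ^ 2 := by
  rcases hst.eq_or_lt with rfl | hlt
  · simp
  have hδ : 0 < t - s := sub_pos.2 hlt
  set m := ∫ r in s..t, g r with hm
  have h0 : 0 ≤ ∫ r in s..t, ((t - s) * g r - m) ^ 2 :=
    intervalIntegral.integral_nonneg hst fun r _ => sq_nonneg _
  have h1 : ∫ r in s..t, ((t - s) * g r - m) ^ 2 =
      (t - s) * ((t - s) * (∫ r in s..t, g r ^ 2) - m ^ 2) := by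
    have : ∀ r, ((t - s) * g r - m) ^ 2 =
        ((t - s) ^ 2 * g r ^ 2 - 2 * (t - s) * m * g r) + m ^ 2 := fun r => by ring
    simp_rw [this]
    rw [intervalIntegral.integral_add ((hg2.const_mul _).sub (hg.const_mul _))
      intervalIntegrable_const, intervalIntegral.integral_sub (hg2.const_mul _) (hg.const_mul _),
      intervalIntegral.integral_const_mul, intervalIntegral.integral_const_mul,
      intervalIntegral.integral_const, ← hm, smul_eq_mul]
    ring
  rw [h1] at h0
  have := nonneg_of_mul_nonneg_right h0 hδ
  linarith

/-- The increment of `G` along a straight line, compared with its increment along the flow. -/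
theorem IsFlow.abs_sub_sub_integral_le (hψ : IsFlow b ψ) (hb : IsLipschitzField K b)
    {G : Vec d → ℝ} {DG : Vec d → Vec d →L[ℝ] ℝ} {L M : ℝ} (hL0 : 0 ≤ L) (hM0 : 0 ≤ M)
    (hG : ∀ x, HasFDerivAt G (DG x) x) (hGL : ∀ x, ‖DG x‖ ≤ L)
    (hGM : ∀ x x', ‖DG x - DG x'‖ ≤ M * ‖x - x'‖) {s t : ℝ} (hs : 0 ≤ s) (hst : s ≤ t)
    (ht : t ≤ 1) {z : ℝ → Vec d} {V : Vec d} (hz : ∀ r, z r = z s + (r - s) • V)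
    (W : ℝ) (hW : W = ∫ r in s..t, (‖V‖ + ‖b (z r) r‖)) :
    |G (z t) - G (ψ s t (z s)) - ∫ r in s..t, DG (z r) (V - b (z r) r)| ≤
      (M * (Real.exp K + 1) * Real.exp K + M) * W ^ 2
        + L * K * Real.exp K * (t - s) * W := by
  set E := Real.exp K with hE
  have hE0 : 0 < E := Real.exp_pos _
  have hδ : 0 ≤ t - s := sub_nonneg.2 hst
  have hzc : Continuous z := by
    have : z = fun r => z s + (r - s) • V := funext hz
    rw [this]; fun_prop
  have hψc := hψ.continuous s (z s)
  have hα : IntervalIntegrable (fun r => b (z r) r) volume s t :=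
    hb.intervalIntegrable hzc.continuousOn
  have hβ : IntervalIntegrable (fun r => b (ψ s r (z s)) r) volume s t :=
    hb.intervalIntegrable hψc.continuousOn
  have hVi : IntervalIntegrable (fun _ : ℝ => V) volume s t := intervalIntegrable_const
  have hDc : Continuous DG := by
    refine (LipschitzWith.of_dist_le_mul (K := ⟨M, hM0⟩) fun x y => ?_).continuous
    rw [dist_eq_norm, dist_eq_norm]; exact hGM x y
  have hWi : IntervalIntegrable (fun r => ‖V‖ + ‖b (z r) r‖) volume s t :=
    intervalIntegrable_const.add hα.norm
  have hW0 : 0 ≤ W := by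
    rw [hW]; exact intervalIntegral.integral_nonneg hst fun r _ => by positivity
  have hVW : (t - s) * ‖V‖ ≤ W := by
    rw [hW, intervalIntegral.integral_add intervalIntegrable_const hα.norm,
      intervalIntegral.integral_const, smul_eq_mul]
    have : 0 ≤ ∫ r in s..t, ‖b (z r) r‖ :=
      intervalIntegral.integral_nonneg hst fun r _ => norm_nonneg _
    linarith
  have hsubW : ∫ r in s..t, ‖V - b (z r) r‖ ≤ W := by
    rw [hW]
    exact intervalIntegral.integral_mono_on hst (hVi.sub hα).norm hWi fun r _ => _root_.norm_sub_le _ _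
  have hzV : ∀ r ∈ Icc s t, ‖z r - z s‖ ≤ W := fun r hr => by
    rw [hz r, add_sub_cancel_left, norm_smul, Real.norm_of_nonneg (sub_nonneg.2 hr.1)]
    refine le_trans ?_ hVW
    gcongr
    exact hr.2
  -- The segment is a path of velocity `V`, so stability bounds its distance to the flow by the
  -- integrated defect ‖V - b‖, which is at most `W`.
  have hψz : ∀ r ∈ Icc s t, ‖ψ s r (z s) - z r‖ ≤ E * W := fun r hr => by
    have h1 := hψ.norm_sub_le hb (x := z s) (x' := z s) ht hzc.continuousOn hVi
      (fun q _ => by rw [intervalIntegral.integral_const]; exact hz q) r hr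
    refine h1.trans ?_
    rw [sub_self, norm_zero, zero_add, mul_comm]
    have h2 : 0 ≤ ∫ r in s..t, ‖V - b (z r) r‖ :=
      intervalIntegral.integral_nonneg hst fun r _ => norm_nonneg _
    have h3 : Real.exp (K * (r - s)) ≤ E := by
      rw [hE]
      refine Real.exp_le_exp.2 (mul_le_of_le_one_right K.coe_nonneg ?_)
      linarith [hr.2]
    gcongr
  have hmem : t ∈ Icc s t := ⟨hst, le_rfl⟩
  have hψp : ‖ψ s t (z s) - z s‖ ≤ (E + 1) * W := by
    have := norm_add_le (ψ s t (z s) - z t) (z t - z s)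
    rw [sub_add_sub_cancel] at this
    linarith [hψz t hmem, hzV t hmem]
  -- Linearization at `z s` on the ball of radius (E + 1) W, which contains both endpoints.
  have hTaylor : ‖G (z t) - G (ψ s t (z s)) - DG (z s) (z t - ψ s t (z s))‖ ≤
      M * ((E + 1) * W) * (E * W) := by
    have h1 := (convex_closedBall (z s) ((E + 1) * W)).norm_image_sub_le_of_norm_hasFDerivWithin_le'
      (f := G) (f' := DG) (φ := DG (z s)) (C := M * ((E + 1) * W)) (x := ψ s t (z s)) (y := z t)
      (fun x _ => (hG x).hasFDerivWithinAt)
      (fun x hx => (hGM x (z s)).trans (by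
        gcongr; rwa [mem_closedBall_iff_norm] at hx))
      (by rwa [mem_closedBall_iff_norm])
      (by
        rw [mem_closedBall_iff_norm]
        refine (hzV t hmem).trans ?_
        nlinarith)
    refine h1.trans ?_
    rw [norm_sub_rev]
    exact mul_le_mul_of_nonneg_left (hψz t hmem) (by positivity)
  have hdiff : z t - ψ s t (z s) = ∫ r in s..t, (V - b (ψ s r (z s)) r) := by
    rw [intervalIntegral.integral_sub hVi hβ, intervalIntegral.integral_const, hz t,
      hψ.eq s (z s) t ⟨hst, ht⟩]
    abel
  have hDint : ∀ {y : ℝ → Vec d}, Continuous y → ∀ {g : ℝ → Vec d},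
      IntervalIntegrable g volume s t → IntervalIntegrable (fun r => DG (y r) (g r)) volume s t := by
    intro y hy g hg
    rw [intervalIntegrable_iff] at hg ⊢
    refine Integrable.mono' (hg.norm.const_mul L) ?_ (ae_of_all _ fun r =>
      ((DG (y r)).le_opNorm _).trans (by gcongr; exact hGL _))
    exact (measurable_clm_apply (ℓ := fun q : Vec d × Vec d => DG q.1) (y := Prod.snd)
      (hDc.measurable.comp measurable_fst) measurable_snd).comp_aemeasurable
      (hy.measurable.aemeasurable.prodMk hg.aestronglyMeasurable.aemeasurable) |>.aestronglyMeasurable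
  -- Two replacements: the field along the flow by the field along the segment, costing L K E (t -
  -- s) W, and the derivative at `z s` by that at `z r`, costing M W².
  have hlin : |DG (z s) (z t - ψ s t (z s)) - ∫ r in s..t, DG (z r) (V - b (z r) r)| ≤
      L * K * E * (t - s) * W + M * W ^ 2 := by
    rw [hdiff, ← (DG (z s)).intervalIntegral_comp_comm (hVi.sub hβ),
      ← intervalIntegral.integral_sub (hDint continuous_const (hVi.sub hβ))
        (hDint hzc (hVi.sub hα)), ← Real.norm_eq_abs]
    have hbound : ∫ r in s..t, (L * (K * (E * W)) + M * W * (‖V‖ + ‖b (z r) r‖)) =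
        L * K * E * (t - s) * W + M * W ^ 2 := by
      rw [intervalIntegral.integral_add intervalIntegrable_const (hWi.const_mul _),
        intervalIntegral.integral_const, intervalIntegral.integral_const_mul, ← hW, smul_eq_mul]
      ring
    rw [← hbound]
    refine intervalIntegral.norm_integral_le_of_norm_le hst (ae_of_all _ fun r hr => ?_)
      (intervalIntegrable_const.add (hWi.const_mul _))
    have hr' : r ∈ Icc s t := Ioc_subset_Icc_self hr
    have hsplit : DG (z s) (V - b (ψ s r (z s)) r) - DG (z r) (V - b (z r) r) =
        DG (z s) (b (z r) r - b (ψ s r (z s)) r) + (DG (z s) - DG (z r)) (V - b (z r) r) := by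
      simp only [map_sub, sub_apply]; ring
    rw [hsplit]
    refine (norm_add_le _ _).trans (add_le_add ?_ ?_)
    · refine ((DG (z s)).le_opNorm _).trans ?_
      have h1 : ‖b (z r) r - b (ψ s r (z s)) r‖ ≤ K * (E * W) := by
        refine (hb.norm_sub_le _ _ _).trans ?_
        rw [norm_sub_rev]
        exact mul_le_mul_of_nonneg_left (hψz r hr') K.coe_nonneg
      exact mul_le_mul (hGL _) h1 (norm_nonneg _) hL0
    · refine ((DG (z s) - DG (z r)).le_opNorm _).trans ?_
      have h1 : ‖DG (z s) - DG (z r)‖ ≤ M * W := by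
        refine (hGM _ _).trans ?_
        rw [norm_sub_rev]
        exact mul_le_mul_of_nonneg_left (hzV r hr') hM0
      exact mul_le_mul h1 (_root_.norm_sub_le _ _) (norm_nonneg _) (by positivity)
  rw [Real.norm_eq_abs] at hTaylor
  have htri := abs_add_le (G (z t) - G (ψ s t (z s)) - DG (z s) (z t - ψ s t (z s)))
    (DG (z s) (z t - ψ s t (z s)) - ∫ r in s..t, DG (z r) (V - b (z r) r))
  rw [sub_add_sub_cancel] at htri
  refine htri.trans ((add_le_add hTaylor hlin).trans (le_of_eq ?_))
  ring

end OneStep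

/-! ### Averaged one-step estimate and transport along the flow. -/

section FlowStep

variable {d : ℕ} {Ω : Type*} [MeasurableSpace Ω] {P : Measure Ω} [IsProbabilityMeasure P]
  {X₀ X₁ : Ω → Vec d} {K : ℝ≥0} {b : Vec d → ℝ → Vec d} {ψ : ℝ → ℝ → Vec d → Vec d}

/-- The constant e^K does not depend on the times, so all functions f ∘ ψ_{t,T} share one Lipschitz
constant. -/
theorem IsFlow.lipschitzWith (hψ : IsFlow b ψ) (hb : IsLipschitzField K b) {s t : ℝ}
    (hs : 0 ≤ s) (hst : s ≤ t) (ht : t ≤ 1) :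
    LipschitzWith (Real.toNNReal (Real.exp K)) (ψ s t) := by
  refine LipschitzWith.of_dist_le_mul fun x y => ?_
  rw [dist_eq_norm, dist_eq_norm, Real.coe_toNNReal _ (Real.exp_pos _).le, mul_comm]
  refine (hψ.norm_sub_le_mul_exp hb hst ht x y).trans ?_
  gcongr
  exact mul_le_of_le_one_right K.coe_nonneg (by linarith)

/-- Over a short time, moving along the interpolant and moving along the flow have nearly the same
effect on the mean of a smooth function. -/
theorem IsFlow.exists_abs_integral_sub_le (hψ : IsFlow b ψ) (hb : IsLipschitzField K b)
    (hX₀ : Measurable X₀) (hX₁ : Measurable X₁) (hL2 : MemLp (targetVelocity X₀ X₁) 2 P)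
    (hae : ∀ᵐ t ∂(volume.restrict (Icc (0 : ℝ) 1)), ∀ᵐ x ∂(marginalPath P X₀ X₁ t),
      b x t = conditionalVelocity P X₀ X₁ t x)
    {L M : ℝ} (hL0 : 0 ≤ L) (hM0 : 0 ≤ M) :
    ∃ C : ℝ, 0 ≤ C ∧ ∀ (G : Vec d → ℝ) (DG : Vec d → Vec d →L[ℝ] ℝ) (B : ℝ),
      (∀ x, HasFDerivAt G (DG x) x) → (∀ x, ‖DG x‖ ≤ L) →
      (∀ x x', ‖DG x - DG x'‖ ≤ M * ‖x - x'‖) → (∀ x, |G x| ≤ B) →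
      ∀ s t, 0 ≤ s → s ≤ t → t ≤ 1 →
        |∫ ω, G (interpolant X₀ X₁ t ω) ∂P - ∫ ω, G (ψ s t (interpolant X₀ X₁ s ω)) ∂P| ≤
          C * (t - s) ^ 2 := by
  set E := Real.exp K with hE
  have hE0 : 0 < E := Real.exp_pos _
  set c₁ := M * (E + 1) * E + M with hc₁
  set c₂ := L * K * E with hc₂
  have hc₁0 : 0 ≤ c₁ := by positivity
  have hc₂0 : 0 ≤ c₂ := by positivity
  set A := ∫ ω, ‖targetVelocity X₀ X₁ ω‖ ^ 2 ∂P with hA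
  have hA0 : 0 ≤ A := integral_nonneg fun _ => by positivity
  have hV := measurable_targetVelocity hX₀ hX₁
  have hVsq := (memLp_two_iff_integrable_sq_norm hL2.1).1 hL2
  have hm := measurable_velocity_along hX₀ hX₁ hb.measurable
  have hI := measurable_interpolant_uncurry (X₀ := X₀) (X₁ := X₁) hX₀ hX₁
  -- From W² ≤ (t - s) Q with E Q ≤ 4A (t - s), and (t - s) W ≤ W² + (t - s)². The constant depends
  -- on `G` only through `L` and `M`, since later `G` varies with time.
  refine ⟨(c₁ + c₂) * (4 * A) + c₂, by positivity, ?_⟩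
  intro G DG B hG hGL hGM hGB s t hs hst ht
  have hδ : 0 ≤ t - s := sub_nonneg.2 hst
  have hGc : Continuous G := continuous_iff_continuousAt.2 fun x => (hG x).continuousAt
  have hDc : Continuous DG := by
    refine (LipschitzWith.of_dist_le_mul (K := ⟨M, hM0⟩) fun x y => ?_).continuous
    rw [dist_eq_norm, dist_eq_norm]; exact hGM x y
  have hsub : Ioc s t ⊆ Icc (0 : ℝ) 1 := fun r hr => ⟨hs.trans hr.1.le, hr.2.trans ht⟩
  set μ := (volume : Measure ℝ).restrict (Ioc s t) with hμ
  have hle : μ.prod P ≤ ((volume : Measure ℝ).restrict (Icc 0 1)).prod P :=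
    Measure.prod_mono (Measure.restrict_mono hsub le_rfl) le_rfl
  have hb2 : MemLp (fun p : ℝ × Ω => b (interpolant X₀ X₁ p.1 p.2) p.1) 2 (μ.prod P) :=
    (memLp_velocity_along hX₀ hX₁ hL2 hb.measurable hae).mono_measure hle
  have hV2 : MemLp (fun p : ℝ × Ω => targetVelocity X₀ X₁ p.2) 2 (μ.prod P) :=
    hL2.comp_snd μ
  have hbsq := (memLp_two_iff_integrable_sq_norm hb2.1).1 hb2
  have hVsq' := (memLp_two_iff_integrable_sq_norm hV2.1).1 hV2
  have hf : Integrable (fun p : ℝ × Ω => 2 * ‖targetVelocity X₀ X₁ p.2‖ ^ 2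
      + 2 * ‖b (interpolant X₀ X₁ p.1 p.2) p.1‖ ^ 2) (μ.prod P) :=
    (hVsq'.const_mul 2).add (hbsq.const_mul 2)
  -- the quadratic error term
  set Q : Ω → ℝ := fun ω => ∫ r, (2 * ‖targetVelocity X₀ X₁ ω‖ ^ 2
      + 2 * ‖b (interpolant X₀ X₁ r ω) r‖ ^ 2) ∂μ with hQ
  have hQi : Integrable Q P := hf.integral_prod_right
  have hQle : ∫ ω, Q ω ∂P ≤ 4 * A * (t - s) := by
    have hsw : ∫ ω, Q ω ∂P = ∫ r, ∫ ω, (2 * ‖targetVelocity X₀ X₁ ω‖ ^ 2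
        + 2 * ‖b (interpolant X₀ X₁ r ω) r‖ ^ 2) ∂P ∂μ :=
      integral_integral_swap (f := fun ω r => 2 * ‖targetVelocity X₀ X₁ ω‖ ^ 2
        + 2 * ‖b (interpolant X₀ X₁ r ω) r‖ ^ 2) hf.swap
    rw [hsw]
    have hconst : 4 * A * (t - s) = ∫ _, 4 * A ∂μ := by
      rw [integral_const, hμ, measureReal_restrict_apply_univ, Real.volume_real_Ioc_of_le hst,
        smul_eq_mul]
      ring
    rw [hconst]
    refine integral_mono_ae hf.integral_prod_left (integrable_const _) ?_
    filter_upwards [ae_restrict_of_ae_restrict_of_subset hsub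
      (integral_sq_norm_velocity_along_le hX₀ hX₁ hL2 hae)] with r hr
    rw [integral_add (hVsq.const_mul 2) (hr.1.const_mul 2), integral_const_mul, integral_const_mul]
    linarith [hr.2]
  -- the linear term has mean zero
  set I : Ω → ℝ := fun ω => ∫ r, DG (interpolant X₀ X₁ r ω)
    (targetVelocity X₀ X₁ ω - b (interpolant X₀ X₁ r ω) r) ∂μ with hIdef
  have hIint : Integrable (fun p : ℝ × Ω => DG (interpolant X₀ X₁ p.1 p.2)
      (targetVelocity X₀ X₁ p.2 - b (interpolant X₀ X₁ p.1 p.2) p.1)) (μ.prod P) := by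
    refine Integrable.mono' (((hV2.sub hb2).integrable one_le_two).norm.const_mul L)
      (measurable_clm_apply (hDc.measurable.comp hI)
        ((hV.comp measurable_snd).sub hm)).aestronglyMeasurable (ae_of_all _ fun p => ?_)
    exact ((DG _).le_opNorm _).trans (mul_le_mul_of_nonneg_right (hGL _) (norm_nonneg _))
  have hIi : Integrable I P := hIint.integral_prod_right
  have hI0 : ∫ ω, I ω ∂P = 0 := by
    have hsw : ∫ ω, I ω ∂P = ∫ r, ∫ ω, DG (interpolant X₀ X₁ r ω)
        (targetVelocity X₀ X₁ ω - b (interpolant X₀ X₁ r ω) r) ∂P ∂μ :=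
      integral_integral_swap (f := fun ω r => DG (interpolant X₀ X₁ r ω)
        (targetVelocity X₀ X₁ ω - b (interpolant X₀ X₁ r ω) r)) hIint.swap
    rw [hsw]
    refine (integral_congr_ae ?_).trans (integral_zero _ _)
    filter_upwards [ae_restrict_of_ae_restrict_of_subset hsub
      (integral_clm_velocity_along hX₀ hX₁ hL2 hae hDc.measurable hGL),
      (hb2.integrable one_le_two).prod_right_ae] with r hr hbr
    have hXr := measurable_interpolant hX₀ hX₁ r
    have hi : ∀ {g : Ω → Vec d}, Integrable g P →
        Integrable (fun ω => DG (interpolant X₀ X₁ r ω) (g ω)) P := fun {g} hg => by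
      refine Integrable.mono' (hg.norm.const_mul L) ?_ (ae_of_all _ fun ω =>
        ((DG _).le_opNorm _).trans (by gcongr; exact hGL _))
      exact ((measurable_clm_apply (ℓ := fun q : Vec d × Vec d => DG q.1) (y := Prod.snd)
        (hDc.measurable.comp measurable_fst) measurable_snd).comp_aemeasurable
        (hXr.aemeasurable.prodMk hg.1.aemeasurable)).aestronglyMeasurable
    simp_rw [map_sub]
    rw [integral_sub (hi (hL2.integrable one_le_two)) (hi hbr), hr, sub_self]
  -- pointwise estimate
  have hpt : ∀ᵐ ω ∂P, ‖G (interpolant X₀ X₁ t ω) - G (ψ s t (interpolant X₀ X₁ s ω)) - I ω‖ ≤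
      (c₁ + c₂) * (t - s) * Q ω + c₂ * (t - s) ^ 2 := by
    filter_upwards [hbsq.prod_left_ae] with ω hω
    have hz : ∀ r, interpolant X₀ X₁ r ω =
        interpolant X₀ X₁ s ω + (r - s) • targetVelocity X₀ X₁ ω := fun r => by
      rw [interpolant_eq, interpolant_eq, sub_smul]; abel
    have h1 := hψ.abs_sub_sub_integral_le hb hL0 hM0 hG hGL hGM hs hst ht
      (z := fun r => interpolant X₀ X₁ r ω) hz _ rfl
    set W := ∫ r in s..t, (‖targetVelocity X₀ X₁ ω‖ + ‖b (interpolant X₀ X₁ r ω) r‖) with hW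
    have hbi : IntervalIntegrable (fun r => b (interpolant X₀ X₁ r ω) r) volume s t :=
      hb.intervalIntegrable (continuous_interpolant_time ω).continuousOn
    have hbi2 : IntervalIntegrable (fun r => ‖b (interpolant X₀ X₁ r ω) r‖ ^ 2) volume s t :=
      (intervalIntegrable_iff_integrableOn_Ioc_of_le hst).2 hω
    have hg2 : IntervalIntegrable
        (fun r => (‖targetVelocity X₀ X₁ ω‖ + ‖b (interpolant X₀ X₁ r ω) r‖) ^ 2) volume s t := by
      have : (fun r => (‖targetVelocity X₀ X₁ ω‖ + ‖b (interpolant X₀ X₁ r ω) r‖) ^ 2) =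
          fun r => (‖targetVelocity X₀ X₁ ω‖ ^ 2 +
            2 * ‖targetVelocity X₀ X₁ ω‖ * ‖b (interpolant X₀ X₁ r ω) r‖)
            + ‖b (interpolant X₀ X₁ r ω) r‖ ^ 2 := by funext r; ring
      rw [this]
      exact (intervalIntegrable_const.add (hbi.norm.const_mul _)).add hbi2
    have hWsq : W ^ 2 ≤ (t - s) * Q ω := by
      refine (sq_intervalIntegral_le hst (intervalIntegrable_const.add hbi.norm) hg2).trans ?_
      refine mul_le_mul_of_nonneg_left ?_ hδ
      rw [hQ]
      simp only
      rw [hμ, ← intervalIntegral.integral_of_le hst]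
      refine intervalIntegral.integral_mono_on hst hg2
        (intervalIntegrable_const.add (hbi2.const_mul 2)) fun r _ => ?_
      nlinarith [sq_nonneg (‖targetVelocity X₀ X₁ ω‖ - ‖b (interpolant X₀ X₁ r ω) r‖)]
    rw [Real.norm_eq_abs]
    have hIω : I ω = ∫ r in s..t, DG (interpolant X₀ X₁ r ω)
        (targetVelocity X₀ X₁ ω - b (interpolant X₀ X₁ r ω) r) := by
      rw [intervalIntegral.integral_of_le hst]
    rw [hIω]
    refine h1.trans ?_
    have h2 : (t - s) * W ≤ W ^ 2 + (t - s) ^ 2 := by nlinarith [sq_nonneg (t - s - W)]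
    calc c₁ * W ^ 2 + L * K * E * (t - s) * W = c₁ * W ^ 2 + c₂ * ((t - s) * W) := by
          rw [hc₂]; ring
      _ ≤ c₁ * W ^ 2 + c₂ * (W ^ 2 + (t - s) ^ 2) := by gcongr
      _ = (c₁ + c₂) * W ^ 2 + c₂ * (t - s) ^ 2 := by ring
      _ ≤ (c₁ + c₂) * ((t - s) * Q ω) + c₂ * (t - s) ^ 2 := by gcongr
      _ = _ := by ring
  have hGi : ∀ {Y : Ω → Vec d}, Measurable Y → Integrable (fun ω => G (Y ω)) P := fun hY =>
    Integrable.of_bound (hGc.measurable.comp hY).aestronglyMeasurable B (ae_of_all _ fun ω => hGB _)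
  have hXs := measurable_interpolant hX₀ hX₁ s
  have hXt := measurable_interpolant hX₀ hX₁ t
  have hψm : Measurable fun ω => ψ s t (interpolant X₀ X₁ s ω) :=
    (hψ.lipschitzWith hb hs hst ht).continuous.measurable.comp hXs
  have hfinal := norm_integral_le_of_norm_le
    ((hQi.const_mul ((c₁ + c₂) * (t - s))).add (integrable_const (c₂ * (t - s) ^ 2))) hpt
  have hdi : Integrable (fun ω => G (interpolant X₀ X₁ t ω)
      - G (ψ s t (interpolant X₀ X₁ s ω))) P := (hGi hXt).sub (hGi hψm)
  rw [integral_sub hdi hIi, hI0, sub_zero,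
    integral_sub (hGi hXt) (hGi hψm), Real.norm_eq_abs] at hfinal
  refine hfinal.trans ?_
  simp only [Pi.add_apply]
  rw [integral_add (hQi.const_mul _) (integrable_const _), integral_const_mul, integral_const,
    probReal_univ, one_smul]
  have : (c₁ + c₂) * (t - s) * ∫ ω, Q ω ∂P ≤ (c₁ + c₂) * (t - s) * (4 * A * (t - s)) := by
    gcongr
  linarith

/-- A function whose increments are bounded by `c` times the time step, up to second order,
is `c`-Lipschitz. -/
theorem abs_sub_le_of_increment_le {e : ℝ → ℝ} {T c C : ℝ} (hT : 0 ≤ T)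
    (h : ∀ s t, 0 ≤ s → s ≤ t → t ≤ T → |e t - e s| ≤ c * (t - s) + C * (t - s) ^ 2) :
    |e T - e 0| ≤ c * T := by
  -- With n + 1 equal steps the first-order terms add up to c T, while the second-order ones add up
  -- to C T² / (n + 1).
  have hn : ∀ n : ℕ, |e T - e 0| ≤ c * T + C * T ^ 2 * (1 / ((n : ℝ) + 1)) := fun n => by
    have hn0 : (0 : ℝ) < n + 1 := by positivity
    have h1 := dist_le_range_sum_dist (fun i : ℕ => e (i * (T / (n + 1)))) (n + 1)
    have hlast : ((n + 1 : ℕ) : ℝ) * (T / (n + 1)) = T := by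
      push_cast; field_simp
    simp only [hlast, Nat.cast_zero, zero_mul] at h1
    rw [dist_comm, Real.dist_eq] at h1
    refine h1.trans ?_
    have hterm : ∀ i ∈ Finset.range (n + 1),
        dist (e (i * (T / (n + 1)))) (e ((i + 1 : ℕ) * (T / (n + 1)))) ≤
          c * (T / (n + 1)) + C * (T / (n + 1)) ^ 2 := fun i hi => by
      have hstep : 0 ≤ T / (n + 1) := by positivity
      have hi' : ((i + 1 : ℕ) : ℝ) ≤ (n + 1 : ℕ) := by
        exact_mod_cast Finset.mem_range.1 hi
      have h2 := h (i * (T / (n + 1))) ((i + 1 : ℕ) * (T / (n + 1))) (by positivity)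
        (by gcongr; simp) (by
          calc ((i + 1 : ℕ) : ℝ) * (T / (n + 1)) ≤ (n + 1 : ℕ) * (T / (n + 1)) := by gcongr
            _ = T := hlast)
      rw [dist_comm, Real.dist_eq]
      refine h2.trans (le_of_eq ?_)
      push_cast
      ring
    refine (Finset.sum_le_sum hterm).trans (le_of_eq ?_)
    rw [Finset.sum_const, Finset.card_range, nsmul_eq_mul]
    push_cast
    field_simp
  have hlim : Tendsto (fun n : ℕ => c * T + C * T ^ 2 * (1 / ((n : ℝ) + 1))) atTop
      (𝓝 (c * T + C * T ^ 2 * 0)) :=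
    (tendsto_one_div_add_atTop_nhds_zero_nat.const_mul _).const_add _
  rw [mul_zero, add_zero] at hlim
  exact ge_of_tendsto' hlim hn

/-- The flow transports the initial distribution along the marginal path, tested against bounded
Lipschitz functions. -/
theorem IsFlow.integral_comp_eq (hψ : IsFlow b ψ) (hb : IsLipschitzField K b)
    (hX₀ : Measurable X₀) (hX₁ : Measurable X₁) (hL2 : MemLp (targetVelocity X₀ X₁) 2 P)
    (hae : ∀ᵐ t ∂(volume.restrict (Icc (0 : ℝ) 1)), ∀ᵐ x ∂(marginalPath P X₀ X₁ t),
      b x t = conditionalVelocity P X₀ X₁ t x)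
    {f : Vec d → ℝ} {L : ℝ≥0} {B : ℝ} (hf : LipschitzWith L f) (hB : ∀ x, |f x| ≤ B)
    {T : ℝ} (hT : T ∈ Icc (0 : ℝ) 1) :
    ∫ ω, f (interpolant X₀ X₁ T ω) ∂P = ∫ ω, f (ψ 0 T (interpolant X₀ X₁ 0 ω)) ∂P := by
  set E := Real.exp K with hE
  have hE0 : 0 < E := Real.exp_pos _
  set L' : ℝ≥0 := L * Real.toNNReal E with hL'
  -- Pulling f back along the flow gives h_s = h_t ∘ ψ_{s,t}; the mean of h_t(x_t) interpolates
  -- between the two sides of the claim.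
  let h : ℝ → Vec d → ℝ := fun t x => f (ψ t T x)
  have hlip : ∀ t, 0 ≤ t → t ≤ T → LipschitzWith L' (h t) := fun t h0 h1 =>
    hf.comp (hψ.lipschitzWith hb h0 h1 hT.2)
  have hbd : ∀ t x, |h t x| ≤ B := fun t x => hB _
  have hXm := fun t => measurable_interpolant hX₀ hX₁ (t := t)
  have hint : ∀ {g : Vec d → ℝ}, Continuous g → (∀ x, |g x| ≤ B) → ∀ {Y : Ω → Vec d},
      Measurable Y → Integrable (fun ω => g (Y ω)) P := fun hg hgB Y hY =>
    Integrable.of_bound (hg.measurable.comp hY).aestronglyMeasurable B (ae_of_all _ fun ω => hgB _)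
  have hmeanle : ∀ {F : Ω → ℝ} {c : ℝ}, (∀ ω, |F ω| ≤ c) → |∫ ω, F ω ∂P| ≤ c := fun {F c} hF => by
    have := norm_integral_le_of_norm_le_const (μ := P) (f := F) (C := c) (ae_of_all _ hF)
    simpa using this
  -- The term 2 L' ε comes from removing the mollifier at times 0 and T, and L' K E ε from moving it
  -- through the flow in all steps together.
  have hε : ∀ ε : ℝ, 0 < ε → |∫ ω, f (interpolant X₀ X₁ T ω) ∂P -
      ∫ ω, f (ψ 0 T (interpolant X₀ X₁ 0 ω)) ∂P| ≤ (2 * L' + L' * K * E) * ε := by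
    intro ε hε
    -- Only the outer radius ε enters the estimates.
    let ρ : ContDiffBump (0 : Vec d) := ⟨ε / 2, ε, by positivity, by linarith⟩
    have hρ : ρ.rOut = ε := rfl
    obtain ⟨M, hM0, hM⟩ := exists_hasFDerivAt_mollify ρ L'
    obtain ⟨C, hC0, hC⟩ := hψ.exists_abs_integral_sub_le hb hX₀ hX₁ hL2 hae
      (L := L') L'.coe_nonneg hM0
    let e : ℝ → ℝ := fun t => ∫ ω, mollify ρ (h t) (interpolant X₀ X₁ t ω) ∂P
    have hmc : ∀ t, 0 ≤ t → t ≤ T → Continuous (mollify ρ (h t)) := fun t h0 h1 =>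
      (lipschitzWith_mollify ρ (hlip t h0 h1)).continuous
    have hmB : ∀ t, 0 ≤ t → t ≤ T → ∀ x, |mollify ρ (h t) x| ≤ B := fun t h0 h1 =>
      abs_mollify_le ρ (hlip t h0 h1).continuous (hbd t)
    have hstep : ∀ s t, 0 ≤ s → s ≤ t → t ≤ T →
        |e t - e s| ≤ (L' * K * E * ε) * (t - s) + C * (t - s) ^ 2 := by
      intro s t hs hst ht
      have h0t := hs.trans hst
      have hψst := (hψ.lipschitzWith hb hs hst (ht.trans hT.2)).continuous
      obtain ⟨DG, hG, hGL, hGM⟩ := hM (h t) (hlip t h0t ht)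
      have h1 := hC _ DG B hG hGL hGM (hmB t h0t ht) s t hs hst (ht.trans hT.2)
      have h2 : |∫ ω, mollify ρ (h t) (ψ s t (interpolant X₀ X₁ s ω)) ∂P - e s| ≤
          L' * K * E * ε * (t - s) := by
        simp only [e]
        rw [← integral_sub
          (hint (hmc t h0t ht) (hmB t h0t ht) (Y := fun ω => ψ s t (interpolant X₀ X₁ s ω))
            (hψst.measurable.comp (hXm s)))
          (hint (hmc s hs (hst.trans ht)) (hmB s hs (hst.trans ht)) (hXm s))]
        refine hmeanle fun ω => ?_
        refine abs_mollify_sub_le ρ (hlip t h0t ht).continuous (hlip s hs (hst.trans ht)).continuous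
          fun y hy => ?_
        have hcomp : h s (interpolant X₀ X₁ s ω - y) =
            h t (ψ s t (interpolant X₀ X₁ s ω - y)) := by
          simp only [h]
          rw [hψ.comp hb hst ht hT.2]
        rw [hcomp, ← Real.norm_eq_abs]
        refine ((hlip t h0t ht).norm_sub_le _ _).trans ?_
        rw [norm_sub_rev]
        have h3 := hψ.norm_translate_sub_le hb hst (ht.trans hT.2) (interpolant X₀ X₁ s ω) y
        have h4 : Real.exp (K * (t - s)) ≤ E :=
          Real.exp_le_exp.2 (mul_le_of_le_one_right K.coe_nonneg (by linarith [hT.2]))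
        have h5 : 0 ≤ t - s := sub_nonneg.2 hst
        calc (L' : ℝ) * _ ≤ L' * (K * Real.exp (K * (t - s)) * ‖y‖ * (t - s)) := by gcongr
          _ ≤ L' * (K * E * ε * (t - s)) := by
              rw [hρ] at hy
              gcongr
          _ = _ := by ring
      have h3 := abs_add_le (e t - ∫ ω, mollify ρ (h t) (ψ s t (interpolant X₀ X₁ s ω)) ∂P)
        (∫ ω, mollify ρ (h t) (ψ s t (interpolant X₀ X₁ s ω)) ∂P - e s)
      rw [sub_add_sub_cancel] at h3
      linarith
    have htele := abs_sub_le_of_increment_le hT.1 hstep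
    have hend : ∀ t, 0 ≤ t → t ≤ T →
        |∫ ω, h t (interpolant X₀ X₁ t ω) ∂P - e t| ≤ L' * ε := fun t h0 h1 => by
      simp only [e]
      rw [← integral_sub (hint (hlip t h0 h1).continuous (hbd t) (hXm t))
        (hint (hmc t h0 h1) (hmB t h0 h1) (hXm t))]
      refine hmeanle fun ω => ?_
      rw [abs_sub_comm]
      exact abs_mollify_sub_self_le ρ (hlip t h0 h1) _
    have hendT := hend T hT.1 le_rfl
    have hend0 := hend 0 le_rfl hT.1
    have hTT : ∀ x, h T x = f x := fun x => by simp only [h]; rw [hψ.self hT.2]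
    simp only [hTT] at hendT
    have hTe : L' * K * E * ε * T ≤ L' * K * E * ε := mul_le_of_le_one_right (by positivity) hT.2
    rw [abs_le] at *
    constructor <;> linarith [hendT.1, hendT.2, hend0.1, hend0.2, htele.1, htele.2]
  have hlim : Tendsto (fun ε : ℝ => (2 * L' + L' * K * E) * ε) (𝓝[>] 0) (𝓝 0) := by
    have : Tendsto (fun ε : ℝ => (2 * L' + L' * K * E) * ε) (𝓝 0)
        (𝓝 ((2 * L' + L' * K * E) * 0)) := tendsto_id.const_mul _
    rw [mul_zero] at this
    exact this.mono_left nhdsWithin_le_nhds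
  have h0 := ge_of_tendsto hlim (eventually_nhdsWithin_of_forall hε)
  exact sub_eq_zero.1 (abs_nonpos_iff.1 h0)

end FlowStep

/-! ### From test functions to measures: the flow generates the path. -/

section Transport

variable {d : ℕ}

/-- The real and imaginary parts of a character are bounded and Lipschitz, so the characteristic
functions agree. -/
theorem measure_eq_of_forall_lipschitz_integral_eq {μ ν : Measure (Vec d)} [IsFiniteMeasure μ]
    [IsFiniteMeasure ν]
    (h : ∀ (f : Vec d → ℝ) (L : ℝ≥0), LipschitzWith L f → (∀ x, |f x| ≤ 1) →
      ∫ x, f x ∂μ = ∫ x, f x ∂ν) : μ = ν := by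
  refine Measure.ext_of_charFun (funext fun t => ?_)
  have hlin : LipschitzWith ‖t‖₊ fun x : Vec d => inner ℝ x t := by
    refine LipschitzWith.of_dist_le_mul fun x y => ?_
    rw [Real.dist_eq, ← inner_sub_left, dist_eq_norm, mul_comm]
    exact abs_real_inner_le_norm _ _
  have hcos := h (fun x => Real.cos (inner ℝ x t)) _ (Real.lipschitzWith_cos.comp hlin)
    fun x => Real.abs_cos_le_one _
  have hsin := h (fun x => Real.sin (inner ℝ x t)) _ (Real.lipschitzWith_sin.comp hlin)
    fun x => Real.abs_sin_le_one _
  have key : ∀ (ρ : Measure (Vec d)) [IsFiniteMeasure ρ], charFun ρ t =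
      ((∫ x, Real.cos (inner ℝ x t) ∂ρ : ℝ) : ℂ) +
        ((∫ x, Real.sin (inner ℝ x t) ∂ρ : ℝ) : ℂ) * Complex.I := fun ρ _ => by
    have hc : Integrable (fun x => ((Real.cos (inner ℝ x t) : ℝ) : ℂ)) ρ :=
      (Integrable.of_bound
        (Real.continuous_cos.comp hlin.continuous).aestronglyMeasurable 1
        (ae_of_all _ fun x => Real.abs_cos_le_one (inner ℝ x t))).ofReal
    have hs : Integrable (fun x => ((Real.sin (inner ℝ x t) : ℝ) : ℂ)) ρ :=
      (Integrable.of_bound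
        (Real.continuous_sin.comp hlin.continuous).aestronglyMeasurable 1
        (ae_of_all _ fun x => Real.abs_sin_le_one (inner ℝ x t))).ofReal
    rw [charFun_apply, ← integral_complex_ofReal, ← integral_complex_ofReal,
      ← integral_mul_const, ← integral_add hc (hs.mul_const _)]
    refine integral_congr_ae (ae_of_all _ fun x => ?_)
    simp [Complex.exp_mul_I]
  rw [key μ, key ν, hcos, hsin]

variable {Ω : Type*} [MeasurableSpace Ω] {P : Measure Ω} [IsProbabilityMeasure P]
  {X₀ X₁ : Ω → Vec d} {K : ℝ≥0} {u : Vec d → ℝ → Vec d}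

/-- The field `u`, set to zero outside the time interval `[0, 1]`. -/
noncomputable def unitTimeField (u : Vec d → ℝ → Vec d) (x : Vec d) (t : ℝ) : Vec d :=
  (Icc (0 : ℝ) 1).indicator (u x) t

theorem unitTimeField_of_mem {t : ℝ} (ht : t ∈ Icc (0 : ℝ) 1) (x : Vec d) :
    unitTimeField u x t = u x t := indicator_of_mem ht _

theorem isLipschitzField_unitTimeField (hX₀ : Measurable X₀) (hX₁ : Measurable X₁)
    (hL2 : MemLp (targetVelocity X₀ X₁) 2 P) (hu : Measurable (Function.uncurry u))
    (hae : ∀ᵐ t ∂(volume.restrict (Icc (0 : ℝ) 1)), ∀ᵐ x ∂(marginalPath P X₀ X₁ t),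
      u x t = conditionalVelocity P X₀ X₁ t x)
    (hK : ∀ t ∈ Icc (0 : ℝ) 1, LipschitzWith K fun x => u x t) :
    IsLipschitzField K (unitTimeField u) := by
  refine ⟨?_, fun t => ?_, ?_⟩
  · have : Function.uncurry (unitTimeField u) =
        (Prod.snd ⁻¹' Icc (0 : ℝ) 1).indicator (Function.uncurry u) := by
      funext ⟨x, t⟩
      by_cases ht : t ∈ Icc (0 : ℝ) 1
      · rw [indicator_of_mem (by exact ht)]; exact unitTimeField_of_mem ht x
      · rw [indicator_of_notMem (by exact ht)]; exact indicator_of_notMem ht _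
    rw [this]
    exact hu.indicator (measurable_snd measurableSet_Icc)
  · by_cases ht : t ∈ Icc (0 : ℝ) 1
    · simp only [unitTimeField_of_mem ht]
      exact hK t ht
    · simp only [unitTimeField, indicator_of_notMem ht]
      exact LipschitzWith.const' 0
  · have hint := (memLp_velocity_along hX₀ hX₁ hL2 hu hae).integrable one_le_two
    -- The Lipschitz bound in space gives no integrability in time. By Fubini the field is
    -- integrable along some interpolant path, and the Lipschitz bound carries this to the origin.
    obtain ⟨ω, hω⟩ := hint.prod_left_ae.exists
    refine (integrable_indicator_iff measurableSet_Icc).2 ?_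
    have hc : IntegrableOn (fun s => ‖interpolant X₀ X₁ s ω‖) (Icc (0 : ℝ) 1) :=
      (continuous_interpolant_time ω).norm.continuousOn.integrableOn_Icc
    refine Integrable.mono' (hω.norm.add (hc.const_mul (K : ℝ))) ?_ ?_
    · exact (hu.comp (measurable_const.prodMk measurable_id)).aestronglyMeasurable
    · filter_upwards [ae_restrict_mem measurableSet_Icc] with s hs
      have h1 := (hK s hs).norm_sub_le 0 (interpolant X₀ X₁ s ω)
      rw [zero_sub, norm_neg] at h1
      have h2 := norm_add_le (u 0 s - u (interpolant X₀ X₁ s ω) s) (u (interpolant X₀ X₁ s ω) s)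
      rw [sub_add_cancel] at h2
      simp only [Pi.add_apply]
      linarith

/-- A Lipschitz version of the conditional velocity generates the marginal path. -/
theorem generatesPath (hX₀ : Measurable X₀) (hX₁ : Measurable X₁)
    (hL2 : MemLp (targetVelocity X₀ X₁) 2 P) (hu : Measurable (Function.uncurry u))
    (hae : ∀ᵐ t ∂(volume.restrict (Icc (0 : ℝ) 1)), ∀ᵐ x ∂(marginalPath P X₀ X₁ t),
      u x t = conditionalVelocity P X₀ X₁ t x)
    (hK : ∀ t ∈ Icc (0 : ℝ) 1, LipschitzWith K fun x => u x t) :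
    GeneratesPath u (P.map X₀) (marginalPath P X₀ X₁) := by
  have hb := isLipschitzField_unitTimeField hX₀ hX₁ hL2 hu hae hK
  obtain ⟨ψ, hψ⟩ := hb.exists_isFlow
  have hbae : ∀ᵐ t ∂(volume.restrict (Icc (0 : ℝ) 1)), ∀ᵐ x ∂(marginalPath P X₀ X₁ t),
      unitTimeField u x t = conditionalVelocity P X₀ X₁ t x := by
    filter_upwards [hae, ae_restrict_mem measurableSet_Icc] with t ht ht1
    filter_upwards [ht] with x hx
    rw [unitTimeField_of_mem ht1, hx]
  have hcongr : ∀ (y : ℝ → Vec d) {t : ℝ}, t ∈ Icc (0 : ℝ) 1 →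
      ∫ s in (0 : ℝ)..t, unitTimeField u (y s) s = ∫ s in (0 : ℝ)..t, u (y s) s := by
    intro y t ht
    refine intervalIntegral.integral_congr fun s hs => ?_
    rw [uIcc_of_le ht.1] at hs
    exact unitTimeField_of_mem ⟨hs.1, hs.2.trans ht.2⟩ _
  refine ⟨fun t x => ψ 0 t x, fun x => ⟨?_, fun t ht => ?_⟩, fun x y hy => ?_, fun t ht => ?_⟩
  · refine (hb.intervalIntegrable (hψ.continuous 0 x).continuousOn).congr fun s hs => ?_
    rw [uIoc_of_le zero_le_one] at hs
    exact unitTimeField_of_mem ⟨hs.1.le, hs.2⟩ _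
  · rw [← hcongr _ ht]
    exact hψ.eq 0 x t ht
  -- `IsODESolution` does not ask for continuity; it holds because `y` is a primitive of an
  -- integrable function.
  · have hyc : ContinuousOn y (Icc 0 1) := by
      have h1 := intervalIntegral.continuousOn_primitive_interval (a := (0 : ℝ)) (b := 1)
        (f := fun s => u (y s) s) (μ := volume)
        ((intervalIntegrable_iff').1 hy.1)
      rw [uIcc_of_le zero_le_one] at h1
      exact (continuousOn_const.add h1).congr hy.2
    exact hψ.eq_of_integral_eq hb le_rfl hyc fun t ht => by rw [hcongr y ht]; exact hy.2 t ht
  · have hψm := (hψ.lipschitzWith hb le_rfl ht.1 ht.2).continuous.measurable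
    refine ⟨hψm, ?_⟩
    have hXt := measurable_interpolant hX₀ hX₁ t
    rw [Measure.map_map hψm hX₀, marginalPath]
    have : IsProbabilityMeasure (P.map (ψ 0 t ∘ X₀)) :=
      Measure.isProbabilityMeasure_map (hψm.comp hX₀).aemeasurable
    have : IsProbabilityMeasure (P.map (interpolant X₀ X₁ t)) :=
      Measure.isProbabilityMeasure_map hXt.aemeasurable
    refine measure_eq_of_forall_lipschitz_integral_eq fun f L hf hf1 => ?_
    rw [integral_map (hψm.comp hX₀).aemeasurable hf.continuous.aestronglyMeasurable,
      integral_map hXt.aemeasurable hf.continuous.aestronglyMeasurable,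
      hψ.integral_comp_eq hb hX₀ hX₁ hL2 hbae hf hf1 ht]
    simp [interpolant]

end Transport

/-! ### Continuous fields: from almost every time and scale to all. -/

section ContinuousField

variable {d : ℕ} {Ω : Type*} [MeasurableSpace Ω] {P : Measure Ω} [IsProbabilityMeasure P]
  {X₀ X₁ : Ω → Vec d}

theorem Icc_subset_closure_of_ae {a b : ℝ} (hab : a < b) {p : ℝ → Prop}
    (h : ∀ᵐ t ∂(volume.restrict (Icc a b)), p t) :
    Icc a b ⊆ closure {t | t ∈ Ioo a b ∧ p t} := by
  have h1 : ∀ᵐ t, t ∈ Icc a b → p t := (ae_restrict_iff' measurableSet_Icc).1 h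
  have h2 : Ioo a b ⊆ closure {t | t ∈ Ioo a b ∧ p t} := by
    refine ((Measure.dense_of_ae h1).open_subset_closure_inter isOpen_Ioo).trans
      (closure_mono fun t ht => ⟨ht.1, ht.2 (Ioo_subset_Icc_self ht.1)⟩)
  rw [← closure_Ioo hab.ne]
  exact closure_minimal h2 isClosed_closure

/-- Pairing with a fixed vector reduces the vector identity to `integral_clm_condMean`. -/
theorem integral_smul_condMean {X Y : Ω → Vec d} (hX : Measurable X) (hYm : Measurable Y)
    (hY : MemLp Y 2 P) {g : Vec d → ℝ} (hg : Measurable g) {C : ℝ} (hC : ∀ x, ‖g x‖ ≤ C) :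
    ∫ ω, g (X ω) • Y ω ∂P = ∫ ω, g (X ω) • condMean P X Y (X ω) ∂P := by
  have hi : ∀ {Z : Ω → Vec d}, MemLp Z 2 P → Integrable (fun ω => g (X ω) • Z ω) P := fun hZ =>
    (hZ.integrable one_le_two).bdd_smul C (hg.comp hX).aestronglyMeasurable
      (ae_of_all _ fun ω => hC _)
  refine ext_inner_left ℝ fun w => ?_
  rw [← integral_inner (hi hY), ← integral_inner (hi (memLp_condMean hX hY))]
  have h := integral_clm_condMean hX hYm (hY.integrable one_le_two)
    (ℓ := fun x => g x • innerSL ℝ w) (hg.smul_const _) (by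
      simpa [inner_smul_right] using (hi hY).const_inner (𝕜 := ℝ) w)
  simpa [inner_smul_right] using h

/-- For a field that is continuous in time and space, the identity with the conditional velocity
extends from almost all times to all times. -/
theorem ae_eq_conditionalVelocity_of_continuousOn (hX₀ : Measurable X₀) (hX₁ : Measurable X₁)
    (hL2 : MemLp (targetVelocity X₀ X₁) 2 P) {u : Vec d → ℝ → Vec d}
    (hu : Measurable (Function.uncurry u))
    (huc : ContinuousOn (Function.uncurry u) (univ ×ˢ Icc (0 : ℝ) 1))
    (hae : ∀ᵐ t ∂(volume.restrict (Icc (0 : ℝ) 1)), ∀ᵐ x ∂(marginalPath P X₀ X₁ t),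
      u x t = conditionalVelocity P X₀ X₁ t x) :
    ∀ t ∈ Icc (0 : ℝ) 1, ∀ᵐ x ∂(marginalPath P X₀ X₁ t),
      u x t = conditionalVelocity P X₀ X₁ t x := by
  have hV := measurable_targetVelocity hX₀ hX₁
  have hus : ∀ t, Measurable fun x => u x t := fun t =>
    hu.comp (measurable_id.prodMk measurable_const)
  have hXt := fun t => measurable_interpolant hX₀ hX₁ (t := t)
  have hucx : ∀ t ∈ Icc (0 : ℝ) 1, Continuous fun x => u x t := fun t ht => by
    rw [← continuousOn_univ]
    exact huc.comp (continuous_id.prodMk continuous_const).continuousOn fun x _ => ⟨mem_univ _, ht⟩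
  -- the identity in tested form holds at all times
  have htest : ∀ g : Vec d → ℝ, Continuous g → HasCompactSupport g → ∀ t ∈ Icc (0 : ℝ) 1,
      ∫ ω, g (interpolant X₀ X₁ t ω) • targetVelocity X₀ X₁ ω ∂P =
        ∫ ω, g (interpolant X₀ X₁ t ω) • u (interpolant X₀ X₁ t ω) t ∂P := by
    intro g hg hgc
    obtain ⟨C, hC⟩ := hgc.exists_bound_of_continuous hg
    have hgu : ContinuousOn (fun p : Vec d × ℝ => g p.1 • u p.1 p.2) (univ ×ˢ Icc (0 : ℝ) 1) :=
      (hg.comp continuous_fst).continuousOn.smul huc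
    -- The field may be unbounded in space; the compact support of the test function provides the
    -- uniform bound for dominated convergence.
    obtain ⟨C', hC'⟩ := (hgc.isCompact.prod (isCompact_Icc (a := (0 : ℝ)) (b := 1))).exists_bound_of_continuousOn
      (hgu.mono (prod_mono_left (subset_univ _)))
    have hbd : ∀ x, ∀ t ∈ Icc (0 : ℝ) 1, ‖g x • u x t‖ ≤ max C' 0 := fun x t ht => by
      by_cases hx : x ∈ tsupport g
      · exact (hC' (x, t) ⟨hx, ht⟩).trans (le_max_left _ _)
      · rw [image_eq_zero_of_notMem_tsupport hx, zero_smul, norm_zero]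
        exact le_max_right _ _
    have hEq := Icc_subset_closure_of_ae zero_lt_one hae
    refine Set.EqOn.of_subset_closure (s := {t | t ∈ Ioo (0 : ℝ) 1 ∧
      ∀ᵐ x ∂(marginalPath P X₀ X₁ t), u x t = conditionalVelocity P X₀ X₁ t x}) ?_ ?_ ?_
      (fun t ht => Ioo_subset_Icc_self ht.1) hEq
    · rintro t ⟨-, ht⟩
      simp only
      rw [integral_smul_condMean (hXt t) hV hL2 hg.measurable hC]
      refine integral_congr_ae ?_
      filter_upwards [ae_of_ae_map (hXt t).aemeasurable ht] with ω hω
      rw [hω]; rfl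
    · refine continuousOn_of_dominated (bound := fun ω => C * ‖targetVelocity X₀ X₁ ω‖)
        (fun t _ => ((hg.measurable.comp (hXt t)).smul hV).aestronglyMeasurable)
        (fun t _ => ae_of_all _ fun ω => ?_) ((hL2.integrable one_le_two).norm.const_mul C)
        (ae_of_all _ fun ω => ?_)
      · rw [norm_smul]
        exact mul_le_mul_of_nonneg_right (hC _) (norm_nonneg _)
      · exact ((hg.comp (continuous_interpolant_time ω)).smul continuous_const).continuousOn
    · refine continuousOn_of_dominated (bound := fun _ => max C' 0)
        (fun t _ => ((hg.measurable.comp (hXt t)).smul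
          ((hus t).comp (hXt t))).aestronglyMeasurable)
        (fun t ht => ae_of_all _ fun ω => hbd _ t ht) (integrable_const _)
        (ae_of_all _ fun ω => ?_)
      exact hgu.comp ((continuous_interpolant_time ω).prodMk continuous_id).continuousOn
        fun t ht => ⟨mem_univ _, ht⟩
  intro t ht
  have : IsProbabilityMeasure (marginalPath P X₀ X₁ t) :=
    Measure.isProbabilityMeasure_map (hXt t).aemeasurable
  have hgm : Measurable (conditionalVelocity P X₀ X₁ t) := measurable_condMean
  have hgi : Integrable (conditionalVelocity P X₀ X₁ t) (marginalPath P X₀ X₁ t) :=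
    (integrable_map_measure hgm.aestronglyMeasurable (hXt t).aemeasurable).2
      ((memLp_condMean (hXt t) hL2).integrable one_le_two)
  have hloc : LocallyIntegrable (fun x => u x t - conditionalVelocity P X₀ X₁ t x)
      (marginalPath P X₀ X₁ t) :=
    ((hucx t ht).locallyIntegrable).sub hgi.locallyIntegrable
  -- Smooth compactly supported tests determine a locally integrable function almost everywhere.
  have hzero := ae_eq_zero_of_integral_contDiff_smul_eq_zero hloc fun g hg hgc => by
    obtain ⟨C, hC⟩ := hgc.exists_bound_of_continuous hg.continuous
    have hi1 : Integrable (fun x => g x • u x t) (marginalPath P X₀ X₁ t) :=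
      (hg.continuous.smul (hucx t ht)).integrable_of_hasCompactSupport hgc.smul_right
    have hi2 : Integrable (fun x => g x • conditionalVelocity P X₀ X₁ t x)
        (marginalPath P X₀ X₁ t) :=
      hgi.bdd_smul C hg.continuous.aestronglyMeasurable (ae_of_all _ hC)
    simp_rw [smul_sub]
    rw [integral_sub hi1 hi2, sub_eq_zero, marginalPath,
      integral_map (hXt t).aemeasurable hi1.1, integral_map (hXt t).aemeasurable hi2.1,
      ← htest g hg.continuous hgc t ht]
    exact integral_smul_condMean (hXt t) hV hL2 hg.continuous.measurable hC
  filter_upwards [hzero] with x hx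
  exact sub_eq_zero.1 hx

/-- The admissible pairs of a time and a scale. -/
def timeScaleDomain : Set (ℝ × ℝ) := {p | p.2 ∈ Ioc (0 : ℝ) 1 ∧ p.1 ∈ Icc 0 p.2}

/-- A point (t₀, a₀) is approached in two stages, by good times t in (0, a₀) and then, for each such
t, by good scales in (t, 1). This uses only the iterated a.e. statement and no measurability of `q`.
-/
theorem timeScaleDomain_subset_closure {q : ℝ → ℝ → Prop}
    (h : ∀ᵐ t ∂(volume.restrict (Icc (0 : ℝ) 1)), ∀ᵐ a ∂(volume.restrict (Icc t 1)), q t a) :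
    timeScaleDomain ⊆ closure {p | p ∈ timeScaleDomain ∧ q p.1 p.2} := by
  rintro ⟨t₀, a₀⟩ ⟨ha, ht⟩
  have h1 : ∀ᵐ t ∂(volume.restrict (Icc (0 : ℝ) a₀)), ∀ᵐ a ∂(volume.restrict (Icc t 1)), q t a :=
    ae_restrict_of_ae_restrict_of_subset (Icc_subset_Icc_right ha.2) h
  have h2 := Icc_subset_closure_of_ae ha.1 h1 ht
  have h3 : ∀ t, (t ∈ Ioo 0 a₀ ∧ ∀ᵐ a ∂(volume.restrict (Icc t 1)), q t a) →
      (t, a₀) ∈ closure {p | p ∈ timeScaleDomain ∧ q p.1 p.2} := by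
    rintro t ⟨ht0, hq⟩
    have h4 := Icc_subset_closure_of_ae (ht0.2.trans_le ha.2) hq ⟨ht0.2.le, ha.2⟩
    refine map_mem_closure (f := fun a => (t, a)) (by fun_prop) h4 fun a ha' => ?_
    exact ⟨⟨⟨ht0.1.trans ha'.1.1, ha'.1.2.le⟩, ht0.1.le, ha'.1.1.le⟩, ha'.2⟩
  have h5 := map_mem_closure (f := fun t => (t, a₀)) (by fun_prop) h2 h3
  rwa [closure_closure] at h5

/-- For a continuous field, the scaling identity extends from almost all times and scales to all
times and scales, on the support of the marginal path. -/
theorem scaling_of_continuousOn (hX₀ : Measurable X₀) (hX₁ : Measurable X₁)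
    {v : VelocityField d} (hv : Measurable v)
    (hvc : ContinuousOn v (univ ×ˢ (Icc (0 : ℝ) 1 ×ˢ Ioc (0 : ℝ) 1)))
    (hsc : ∀ᵐ t ∂(volume.restrict (Icc (0 : ℝ) 1)), ∀ᵐ a ∂(volume.restrict (Icc t 1)),
      ∀ᵐ x ∂(marginalPath P X₀ X₁ t), v (x, t / a, a) = a • v (x, t, 1)) :
    ∀ a ∈ Ioc (0 : ℝ) 1, ∀ t ∈ Icc (0 : ℝ) a, ∀ x ∈ (marginalPath P X₀ X₁ t).support,
      v (x, t / a, a) = a • v (x, t, 1) := by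
  -- Truncating the defect at 1 leaves its zero set unchanged and permits dominated convergence
  -- without a growth bound on `v`.
  let c : Vec d × ℝ × ℝ → ℝ := fun p =>
    min 1 ‖v (p.1, p.2.1 / p.2.2, p.2.2) - p.2.2 • v (p.1, p.2.1, 1)‖
  have hcm : Measurable c := by
    have h1 : Measurable fun p : Vec d × ℝ × ℝ => v (p.1, p.2.1 / p.2.2, p.2.2) :=
      hv.comp (by fun_prop)
    have h2 : Measurable fun p : Vec d × ℝ × ℝ => v (p.1, p.2.1, 1) := hv.comp (by fun_prop)
    exact measurable_const.min (h1.sub ((measurable_snd.comp measurable_snd).smul h2)).norm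
  have hcc : ContinuousOn c (univ ×ˢ timeScaleDomain) := by
    have hdiv : ContinuousOn (fun p : Vec d × ℝ × ℝ => p.2.1 / p.2.2) (univ ×ˢ timeScaleDomain) :=
      (continuous_fst.comp continuous_snd).continuousOn.div
        (continuous_snd.comp continuous_snd).continuousOn fun p hp => hp.2.1.1.ne'
    have h1 : ContinuousOn (fun p : Vec d × ℝ × ℝ => v (p.1, p.2.1 / p.2.2, p.2.2))
        (univ ×ˢ timeScaleDomain) :=
      hvc.comp (continuous_fst.continuousOn.prodMk
        (hdiv.prodMk (continuous_snd.comp continuous_snd).continuousOn))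
        fun p hp => ⟨mem_univ _, ⟨div_nonneg hp.2.2.1 hp.2.1.1.le,
          div_le_one_of_le₀ hp.2.2.2 hp.2.1.1.le⟩, hp.2.1⟩
    have h2 : ContinuousOn (fun p : Vec d × ℝ × ℝ => v (p.1, p.2.1, 1))
        (univ ×ˢ timeScaleDomain) :=
      hvc.comp (by fun_prop) fun p hp =>
        ⟨mem_univ _, ⟨hp.2.2.1, hp.2.2.2.trans hp.2.1.2⟩, zero_lt_one, le_rfl⟩
    exact continuousOn_const.inf
      (h1.sub ((continuous_snd.comp continuous_snd).continuousOn.smul h2)).norm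
  have hc0 : ∀ p, 0 ≤ c p := fun p => le_min zero_le_one (norm_nonneg _)
  have hc1 : ∀ p, ‖c p‖ ≤ 1 := fun p => by
    rw [Real.norm_of_nonneg (hc0 p)]; exact min_le_left _ _
  have hc_iff : ∀ x t a, c (x, t, a) = 0 ↔ v (x, t / a, a) = a • v (x, t, 1) := by
    intro x t a
    simp only [c]
    constructor
    · intro h
      rcases min_choice (1 : ℝ) ‖v (x, t / a, a) - a • v (x, t, 1)‖ with h1 | h1
      · rw [h1] at h; exact absurd h one_ne_zero
      · rw [h1] at h; exact sub_eq_zero.1 (norm_eq_zero.1 h)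
    · intro h
      rw [h, sub_self, norm_zero]
      exact min_eq_right zero_le_one
  have hXt := fun t => measurable_interpolant hX₀ hX₁ (t := t)
  have hcω : ∀ t a, Measurable fun ω => c (interpolant X₀ X₁ t ω, t, a) := fun t a =>
    hcm.comp ((hXt t).prodMk measurable_const)
  have hzero : EqOn (fun p : ℝ × ℝ => ∫ ω, c (interpolant X₀ X₁ p.1 ω, p) ∂P) (fun _ => 0)
      timeScaleDomain := by
    refine Set.EqOn.of_subset_closure ?_ ?_ continuousOn_const (fun p hp => hp.1)
      (timeScaleDomain_subset_closure hsc)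
    · rintro ⟨t, a⟩ ⟨-, hp⟩
      refine integral_eq_zero_of_ae ?_
      filter_upwards [ae_of_ae_map (hXt t).aemeasurable hp] with ω hω
      exact (hc_iff _ _ _).2 hω
    · refine continuousOn_of_dominated (bound := fun _ => 1)
        (fun p _ => (hcω p.1 p.2).aestronglyMeasurable) (fun p _ => ae_of_all _ fun ω => hc1 _)
        (integrable_const _) (ae_of_all _ fun ω => ?_)
      exact hcc.comp (((continuous_interpolant_time ω).comp continuous_fst).prodMk
        continuous_id).continuousOn fun p hp => ⟨mem_univ _, hp⟩
  intro a ha t ht x hx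
  have h1 : ∫ ω, c (interpolant X₀ X₁ t ω, t, a) ∂P = 0 := hzero (x := (t, a)) ⟨ha, ht⟩
  rw [integral_eq_zero_iff_of_nonneg (fun ω => hc0 _)
    (Integrable.of_bound (hcω t a).aestronglyMeasurable 1 (ae_of_all _ fun ω => hc1 _))] at h1
  have hclosed : IsClosed {x | c (x, t, a) = 0} := by
    have : Continuous fun x => c (x, t, a) := by
      rw [← continuousOn_univ]
      exact hcc.comp (continuous_id.prodMk continuous_const).continuousOn
        fun x _ => ⟨mem_univ _, ha, ht⟩
    exact isClosed_singleton.preimage this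
  have hmem : {x | c (x, t, a) = 0} ∈ ae (marginalPath P X₀ X₁ t) := by
    have hms : MeasurableSet {x | c (x, t, a) = 0} := hclosed.measurableSet
    exact (ae_map_iff (hXt t).aemeasurable hms).2 h1
  -- A closed set of full measure contains the support, so almost every x becomes every x there.
  exact (hc_iff x t a).1 (Measure.support_subset_of_isClosed hclosed hmem hx)

end ContinuousField

end RecFM

/-! ### The main theorem. -/

theorem mainTheorem3 {d : ℕ} {Ω : Type*} [MeasurableSpace Ω] (P : Measure Ω)
    [IsProbabilityMeasure P] (p₀ p₁ : Measure (RecFM.Vec d)) (X₀ X₁ : Ω → RecFM.Vec d)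
    (hX₀ : Measurable X₀) (hX₁ : Measurable X₁)
    (hp₀ : P.map X₀ = p₀) (hp₁ : P.map X₁ = p₁)
    (hL2 : MemLp (RecFM.targetVelocity X₀ X₁) 2 P)
    (D : ℕ) (hD : 2 ≤ D) (lam : ℝ≥0)
    {Θ : Type*} (v : Θ → RecFM.VelocityField d) (hv : ∀ θ, Measurable (v θ))
    (hexp : RecFM.ExpressiveFor (RecFM.totalLoss P X₀ X₁ D lam) v)
    (θs : Θ)
    (hmin : ∀ θ, RecFM.totalLoss P X₀ X₁ D lam (v θs) ≤ RecFM.totalLoss P X₀ X₁ D lam (v θ)) :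
    -- the minimizers of the primary loss are exactly the versions of the conditional expectation
    (∀ w : RecFM.VelocityField d, Measurable w →
      (RecFM.MinimizesLoss (RecFM.primaryLoss P X₀ X₁) w ↔
        ∀ᵐ t ∂(volume.restrict (Icc (0 : ℝ) 1)), ∀ᵐ x ∂(RecFM.marginalPath P X₀ X₁ t),
          w (x, t, 1) = RecFM.conditionalVelocity P X₀ X₁ t x)) ∧
    -- the minimizers of each secondary loss
    (∀ k, 1 ≤ k → ∀ w : RecFM.VelocityField d, Measurable w →
      (RecFM.MinimizesLoss (RecFM.secondaryLoss P X₀ X₁ k) w ↔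
        ∀ᵐ t ∂(volume.restrict (Icc (0 : ℝ) 1)), ∀ᵐ a ∂(volume.restrict (Icc t 1)),
          ∀ᵐ x ∂(RecFM.marginalPath P X₀ X₁ t),
            w (x, t / a ^ k, a ^ k) = a ^ k • RecFM.conditionalVelocity P X₀ X₁ t x)) ∧
    -- the global minimizer of the total loss minimizes the primary and all secondary losses
    RecFM.MinimizesLoss (RecFM.primaryLoss P X₀ X₁) (v θs) ∧
    (∀ k ∈ Finset.Ico 1 D, RecFM.MinimizesLoss (RecFM.secondaryLoss P X₀ X₁ k) (v θs)) ∧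
    -- the primary velocity is the conditional expectation
    (∀ᵐ t ∂(volume.restrict (Icc (0 : ℝ) 1)), ∀ᵐ x ∂(RecFM.marginalPath P X₀ X₁ t),
      v θs (x, t, 1) = RecFM.conditionalVelocity P X₀ X₁ t x) ∧
    -- it generates the marginal path from `p₀` to `p₁`
    RecFM.marginalPath P X₀ X₁ 0 = p₀ ∧ RecFM.marginalPath P X₀ X₁ 1 = p₁ ∧
    RecFM.SolvesContinuityEquation (fun x t => v θs (x, t, 1)) (RecFM.marginalPath P X₀ X₁) ∧
    ((∃ K : ℝ≥0, ∀ t ∈ Icc (0 : ℝ) 1, LipschitzWith K (fun x => v θs (x, t, 1))) →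
      RecFM.GeneratesPath (fun x t => v θs (x, t, 1)) p₀ (RecFM.marginalPath P X₀ X₁)) ∧
    -- the secondary velocities are the rescaled primary velocity
    (∀ k ∈ Finset.Ico 1 D,
      ∀ᵐ t ∂(volume.restrict (Icc (0 : ℝ) 1)), ∀ᵐ a ∂(volume.restrict (Icc t 1)),
        ∀ᵐ x ∂(RecFM.marginalPath P X₀ X₁ t),
          v θs (x, t / a ^ k, a ^ k) = a ^ k • v θs (x, t, 1)) ∧
    -- the consistency losses vanish
    (∀ k ∈ Finset.Ico 1 D, RecFM.consistencyLoss P X₀ X₁ k (v θs) = 0) ∧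
    -- for a continuous network the identities hold for every time and every scale
    (ContinuousOn (v θs) (univ ×ˢ (Icc (0 : ℝ) 1 ×ˢ Ioc (0 : ℝ) 1)) →
      (∀ t ∈ Icc (0 : ℝ) 1, ∀ᵐ x ∂(RecFM.marginalPath P X₀ X₁ t),
        v θs (x, t, 1) = RecFM.conditionalVelocity P X₀ X₁ t x) ∧
      (∀ a ∈ Ioc (0 : ℝ) 1, ∀ t ∈ Icc (0 : ℝ) a,
        ∀ x ∈ (RecFM.marginalPath P X₀ X₁ t).support,
          v θs (x, t / a, a) = a • v θs (x, t, 1))) := by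
  have hp := RecFM.excess_eq_zero_of_minimizesLoss_totalLoss hX₀ hX₁ hL2 (hv θs)
    -- Expressiveness turns minimality within the class into minimality among all measurable fields.
    (lam := lam) (D := D) fun w hw => (le_iInf hmin).trans (hexp w hw)
  have hprim := (RecFM.primaryExcess_eq_zero_iff hX₀ hX₁ (hv θs)).1 hp.1
  have hu : Measurable (Function.uncurry fun x t => v θs (x, t, 1)) :=
    (hv θs).comp (by fun_prop)
  have hscale : ∀ k ∈ Finset.Ico 1 D,
      ∀ᵐ t ∂(volume.restrict (Icc (0 : ℝ) 1)), ∀ᵐ a ∂(volume.restrict (Icc t 1)),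
        ∀ᵐ x ∂(RecFM.marginalPath P X₀ X₁ t),
          v θs (x, t / a ^ k, a ^ k) = a ^ k • v θs (x, t, 1) := fun k hk => by
    filter_upwards [(RecFM.secondaryExcess_eq_zero_iff hX₀ hX₁ k (hv θs)).1 (hp.2 k hk), hprim]
      with t ht ht1
    filter_upwards [ht] with a ha
    filter_upwards [ha, ht1] with x hx hx1
    rw [hx, hx1]
  refine ⟨fun w hw => ?_, fun k _ w hw => ?_, ?_, fun k hk => ?_, hprim, ?_, ?_,
    RecFM.solvesContinuityEquation hX₀ hX₁ hL2 hu hprim, ?_, hscale,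
    fun k hk => RecFM.consistencyLoss_eq_zero hX₀ hX₁ k (hscale k hk), fun hc => ⟨?_, ?_⟩⟩
  · rw [RecFM.minimizesLoss_primaryLoss_iff hX₀ hX₁ hL2 hw,
      RecFM.primaryExcess_eq_zero_iff hX₀ hX₁ hw]
  · rw [RecFM.minimizesLoss_secondaryLoss_iff hX₀ hX₁ hL2 k hw,
      RecFM.secondaryExcess_eq_zero_iff hX₀ hX₁ k hw]
  · exact (RecFM.minimizesLoss_primaryLoss_iff hX₀ hX₁ hL2 (hv θs)).2 hp.1
  · exact (RecFM.minimizesLoss_secondaryLoss_iff hX₀ hX₁ hL2 k (hv θs)).2 (hp.2 k hk)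
  · rw [← hp₀, RecFM.marginalPath]
    congr 1
    funext ω
    simp [RecFM.interpolant]
  · rw [← hp₁, RecFM.marginalPath]
    congr 1
    funext ω
    simp [RecFM.interpolant]
  · rintro ⟨K, hK⟩
    rw [← hp₀]
    exact RecFM.generatesPath hX₀ hX₁ hL2 hu hprim hK
  · refine RecFM.ae_eq_conditionalVelocity_of_continuousOn hX₀ hX₁ hL2 hu ?_ hprim
    exact hc.comp (by fun_prop) fun p hp => ⟨mem_univ _, hp.2, zero_lt_one, le_rfl⟩
  · refine RecFM.scaling_of_continuousOn hX₀ hX₁ (hv θs) hc ?_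
    -- Depth at least 2 ensures that the trajectory k = 1 is present.
    simpa only [pow_one] using hscale 1 (Finset.mem_Ico.2 ⟨le_rfl, hD⟩)
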